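/- **Setting.** Let $d\in\{2,3\}$ and let $\mathcal K_h$ be a fixed (finite, conforming) simplicial mesh in $\mathbb R^d$ of a polyhedral set $\Omega$, with set of interior faces (edges if $d=2$) $\mathcal E_h^I$; $h_e$ is the length ($d=2$) or area ($d=3$) of $e$. An interior face $e=\partial K_i\cap\partial K_j$, $i<j$, has unit normal $\boldsymbol n_e$ from $K_i$ to $K_j$, jump $[\psi]=\psi|_{K_i}-\psi|_{K_j}$ and average $\{\psi\}=\frac12(\psi|_{K_i}+\psi|_{K_j})$. Write $(\cdot,\cdot)=\sum_K(\cdot,\cdot)_{L^2(K)}$ (derivatives taken elementwise) and $\langle\cdot,\cdot\rangle_e$ for the $L^2(e)$ product. Let $\mathcal Q_h$ be the piecewise constants, $\mathcal V_h$ the discontinuous piecewise linear vector fields, and $\mathcal U_h^0$ the lowest order Raviart–Thomas fields in $H(\mathrm{div},\Omega)$ with zero normal component on $\partial\Omega$. Let $R,T,\beta,\eta,\nu,\kappa^0>0$, $b\in\mathbb R$, $\alpha,\phi_r\in(0,1)$, and put $$f(c)=cRT\ln c-cRT\ln(1-\beta c)+\frac{bc}{2\sqrt2\beta}\ln\frac{1+(1-\sqrt2)\beta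 c}{1+(1+\sqrt2)\beta c},\quad \mu=f',\quad \lambda(\phi)=\frac{\kappa^0}{\nu}\Big(\frac{\phi}{\phi_r}\Big)^3\Big(\frac{1-\phi_r}{1-\phi}\Big)^2,$$ $\varepsilon(\boldsymbol u)=\frac12(\nabla\boldsymbol u+\nabla\boldsymbol u^T)$, $\sigma_e(\boldsymbol u)=2\eta\,\varepsilon(\boldsymbol u)+\gamma(\nabla\cdot\boldsymbol u)I$, and $$\begin{aligned}\mathcal A(\boldsymbol u,p,\boldsymbol v)=&\,(\sigma_e(\boldsymbol u),\varepsilon(\boldsymbol v))-\sum_{e\in\mathcal E_h^I}\langle\{\sigma_e(\boldsymbol u)\boldsymbol n_e\},[\boldsymbol v]\rangle_e-\alpha(p,\nabla\cdot\boldsymbol v)+\alpha\sum_{e\in\mathcal E_h^I}\langle\{p\,\boldsymbol n_e\},[\boldsymbol v]\rangle_e\\&-\sum_{e\in\mathcal E_h^I}\langle[\boldsymbol u],\{\sigma_e(\boldsymbol v)\boldsymbol n_e\}\rangle_e+\sum_{e\in\mathcal E_h^I}\frac{\varsigma_2}{h_e}\langle[\boldsymbol u],[\boldsymbol v]\rangle_e.\end{aligned}$$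 **Old time level.** Let constants $0<\varrho_0$, $\varrho<1$, $0<C_{\phi,min}$, $C_{\phi,max}<1$, $C_\lambda>0$, $0<C_{\mu,min}$, $C_{\mu,max}$, $P$ be given. *Admissible data* are $c_h^n,\phi_h^n,p_h^n\in\mathcal Q_h$, $\boldsymbol u_{s,h}^n\in\mathcal V_h$, $\boldsymbol u_{f,h}^n\in\mathcal U_h^0$, $\theta_n\in\mathbb R$ such that $\varrho_0\le\beta c_h^n\le\varrho$, $C_{\phi,min}\le\phi_h^n\le C_{\phi,max}$, $\lambda^{-1}(\phi_h^n)\ge C_\lambda$, $C_{\mu,min}\le\frac{\theta_nRT}{c_h^n(1-\beta c_h^n)^2}\le C_{\mu,max}$, $|p_h^n|\le P$, and $\mathcal A(\boldsymbol u_{s,h}^n,p_h^n,\boldsymbol v)=0$ for all $\boldsymbol v\in\mathcal V_h$. The upwind value $c_h^{n*}$ on $e$ is $c_h^n|_{K_i}$ if $\boldsymbol u_{f,h}^n\cdot\boldsymbol n_e\ge0$, and $c_h^n|_{K_j}$ otherwise. **Iteration.** Let $N,\tau>0$. To a density $c\in\mathcal Q_h$ belong $\mu_c,p_c,\phi_c\in\mathcal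 Q_h$, $\boldsymbol u_{s,c}\in\mathcal V_h$, $\boldsymbol u_{f,c}\in\mathcal U_h^0$ with $\mu_c=\mu(c_h^n)+\theta_nRT\frac{c-c_h^n}{c_h^n(1-\beta c_h^n)^2}$ and, for all $\boldsymbol v\in\mathcal V_h$, $\boldsymbol w\in\mathcal U_h^0$, $z,\varphi\in\mathcal Q_h$, $$\mathcal A(\boldsymbol u_{s,c},p_c,\boldsymbol v)=0,\quad(\lambda^{-1}(\phi_h^n)\boldsymbol u_{f,c},\boldsymbol w)=\sum_{e\in\mathcal E_h^I}\langle[\mu_c],c_h^{n*}\boldsymbol w\cdot\boldsymbol n_e\rangle_e,\quad(p_c,z)=(c_h^n\mu_c-f(c_h^n),z),$$ $$\Big(\frac{\phi_c-\phi_h^n}{\tau},\varphi\Big)=\frac1N\Big(\frac{p_c-p_h^n}{\tau},\varphi\Big)+\alpha\Big(\frac{\nabla\cdot(\boldsymbol u_{s,c}-\boldsymbol u_{s,h}^n)}{\tau},\varphi\Big)-\alpha\sum_{e\in\mathcal E_h^I}\Big\langle\{\varphi\,\boldsymbol n_e\},\Big[\frac{\boldsymbol u_{s,c}-\boldsymbol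 u_{s,h}^n}{\tau}\Big]\Big\rangle_e.$$ One step of the iteration sends $c=c_h^{n+1,l}$ to $c'=c_h^{n+1,l+1}=\mathcal F_h(c)$ when, for such quantities belonging to $c$ and to $c'$ and for all $q\in\mathcal Q_h$, $$\Big(\frac{\phi_c\,c'-\phi_h^nc_h^n}{\tau},q\Big)+\sum_{e\in\mathcal E_h^I}\langle c_h^{n*}\boldsymbol u_{f,c}\cdot\boldsymbol n_e,[q]\rangle_e+\sum_{e\in\mathcal E_h^I}\frac{\varsigma_1}{h_e}\langle[\mu_{c'}],[q]\rangle_e=0.$$ **Claim.** Let $C>0$ and, for $c\in\mathcal Q_h$, put $$\|c\|_*^2=\frac{3C_{\phi,min}}4\sum_{K\in\mathcal K_h}\|c\|_{L^2(K)}^2+\Big(\varsigma_1C_{\mu,min}-\frac{\varrho^2C}{\beta^2C_\lambda}\Big)\sum_{e\in\mathcal E_h^I}\frac1{h_e}\|[c]\|_{L^2(e)}^2 .$$ There is $B_0$ such that for every $B\ge B_0$ the following holds if the parameters are chosen large enough, successively: $\varsigma_1$ large, then $\gamma$ and $N$ large (depending on $\varsigma_1$), then $\varsigma_2$ large (depending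 on $\varsigma_1,\gamma,N$). Here $B_0$ and all thresholds depend neither on $\tau$ nor on the admissible data, but only on $d$, the mesh, the physical constants $R,T,b,\beta,\eta,\alpha,\nu,\kappa^0,\phi_r$, the constants $\varrho_0,\varrho,C_{\phi,min},C_{\phi,max},C_\lambda,C_{\mu,min},C_{\mu,max},P,C$, and (thresholds only) $B$. First, $\varsigma_1C_{\mu,min}-\frac{\varrho^2C}{\beta^2C_\lambda}>0$. Second, there is $C_{con}\in(0,1)$, independent of $\tau$ and of the admissible data, such that for every $\tau>0$ and all admissible data the step of the iteration is uniquely solvable for $c'$ for every $c$ in the ball $\{c\in\mathcal Q_h:|c|\le B\}$, $\mathcal F_h$ maps this ball into itself, and $$\|\mathcal F_h(c)-\mathcal F_h(\tilde c)\|_*^2<C_{con}\,\|c-\tilde c\|_*^2\qquad\text{for all }c\ne\tilde c\text{ in this ball};$$ in particular this holds for $c=c_h^{n+1,l}$, $\tilde c=c_h^{n+1,l-1}$ as long as the two iterates, both in the ball, differ. -/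

import Mathlib

open MeasureTheory

namespace PoroFlow

noncomputable section

/-! ### Simplicial meshes -/

/-- Points (and vectors) of `ℝ^d` with the Euclidean structure. -/
abbrev Pt (d : ℕ) : Type := EuclideanSpace ℝ (Fin d)

/-- A conforming simplicial mesh in `ℝ^d`. A cell is given by its `d + 1` affinely independent
vertices, the closed element itself being their convex hull. Two closed elements meet exactly in
the convex hull of their common vertices. The meshed set is the union of the elements. -/
structure SimplicialMesh (d : ℕ) where
  numCells : ℕ
  cell : Fin numCells → Finset (Pt d)
  cell_injective : Function.Injective cell
  card_cell : ∀ i, (cell i).card = d + 1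
  indep : ∀ i, AffineIndependent ℝ ((↑) : cell i → Pt d)
  conforming : ∀ i j,
    convexHull ℝ (cell i : Set (Pt d)) ∩ convexHull ℝ (cell j : Set (Pt d)) ⊆
      convexHull ℝ ((cell i : Set (Pt d)) ∩ (cell j : Set (Pt d)))

/-- Barycentre of a finite set of points. -/
def barycentre {d : ℕ} (s : Finset (Pt d)) : Pt d := (s.card : ℝ)⁻¹ • ∑ x ∈ s, x

/-- Unit normal to the face with vertices `s` of the simplex with vertices `K`, pointing out of the
simplex: the normalised component, orthogonal to the face, of the vector from the barycentre of
`K` to the barycentre of `s`. -/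
def outerNormal {d : ℕ} (K s : Finset (Pt d)) : Pt d :=
  let w : Pt d := ((vectorSpan ℝ (s : Set (Pt d)))ᗮ).starProjection (barycentre s - barycentre K)
  ‖w‖⁻¹ • w

namespace SimplicialMesh

variable {d : ℕ} (M : SimplicialMesh d)

/-- Index type of the cells. -/
abbrev Cell : Type := Fin M.numCells

/-- The closed element. -/
def elem (i : M.Cell) : Set (Pt d) := convexHull ℝ (M.cell i : Set (Pt d))

open Classical in
/-- Common vertices of two cells. -/
def faceVerts (e : M.Cell × M.Cell) : Finset (Pt d) := M.cell e.1 ∩ M.cell e.2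

/-- Interior edges (`d = 2`) or faces (`d = 3`): unordered pairs of distinct cells with `d` common
vertices, each written once, as the pair `(i, j)` with `i < j`; the face is oriented from the cell
`i` to the cell `j`. -/
def interiorFaces : Finset (M.Cell × M.Cell) :=
  Finset.univ.filter fun e => e.1 < e.2 ∧ (M.faceVerts e).card = d

/-- The closed face. -/
def face (e : M.Cell × M.Cell) : Set (Pt d) := convexHull ℝ (M.faceVerts e : Set (Pt d))

/-- The unit normal `n_e`, oriented from the first cell to the second one. -/
def normal (e : M.Cell × M.Cell) : Pt d := outerNormal (M.cell e.1) (M.faceVerts e)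

/-- Integral over an element. -/
def cellInt (i : M.Cell) (g : Pt d → ℝ) : ℝ := ∫ x in M.elem i, g x

/-- Integral over a face, for the `(d - 1)`-dimensional surface measure. -/
def faceInt (e : M.Cell × M.Cell) (g : Pt d → ℝ) : ℝ := ∫ x in M.face e, g x ∂(μHE[d - 1])

/-- `h_e`: the length of an edge (`d = 2`), the area of a face (`d = 3`). -/
def hFace (e : M.Cell × M.Cell) : ℝ := ((μHE[d - 1] : Measure (Pt d)) (M.face e)).toReal

/-! ### Discrete spaces

A piecewise polynomial function is given by the coefficients of its polynomial on each cell. -/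

/-- `Q_h`: piecewise constant functions. -/
abbrev Q : Type := M.Cell → ℝ

/-- `V_h`: discontinuous piecewise linear vector fields, `x ↦ a + B x` on each cell. -/
abbrev V : Type := M.Cell → Pt d × Matrix (Fin d) (Fin d) ℝ

/-- Piecewise lowest order Raviart-Thomas fields, `x ↦ a + b x` on each cell with `b` a scalar. -/
abbrev RT : Type := M.Cell → Pt d × ℝ

variable {M}

/-- Value at `x` of the polynomial by which a field of `V_h` is given on the cell `i`. -/
def V.val (u : M.V) (i : M.Cell) (x : Pt d) : Pt d :=
  (u i).1 + WithLp.toLp 2 ((u i).2.mulVec x.ofLp)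

/-- The gradient on a cell. -/
def V.grad (u : M.V) (i : M.Cell) : Matrix (Fin d) (Fin d) ℝ := (u i).2

/-- The divergence on a cell. -/
def V.div (u : M.V) (i : M.Cell) : ℝ := (u.grad i).trace

/-- The strain tensor on a cell. -/
def V.strain (u : M.V) (i : M.Cell) : Matrix (Fin d) (Fin d) ℝ :=
  (1 / 2 : ℝ) • (u.grad i + (u.grad i).transpose)

/-- The effective stress `2 η ε(u) + γ div(u) I` on a cell. -/
def V.stress (η γ : ℝ) (u : M.V) (i : M.Cell) : Matrix (Fin d) (Fin d) ℝ :=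
  (2 * η) • u.strain i + (γ * u.div i) • (1 : Matrix (Fin d) (Fin d) ℝ)

/-- The jump `[u] = u|_{K_i} - u|_{K_j}` on the face `e = (i, j)`. -/
def V.jump (u : M.V) (e : M.Cell × M.Cell) (x : Pt d) : Pt d := u.val e.1 x - u.val e.2 x

/-- The average normal stress `{σ_e(u) n_e}` on the face `e`. -/
def V.avgStress (η γ : ℝ) (u : M.V) (e : M.Cell × M.Cell) : Pt d :=
  (1 / 2 : ℝ) • (WithLp.toLp 2 ((u.stress η γ e.1).mulVec (M.normal e).ofLp) +
    WithLp.toLp 2 ((u.stress η γ e.2).mulVec (M.normal e).ofLp))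

/-- The jump `[q] = q|_{K_i} - q|_{K_j}` on the face `e = (i, j)`. -/
def Q.jump (q : M.Q) (e : M.Cell × M.Cell) : ℝ := q e.1 - q e.2

/-- The average `{q n_e}` on the face `e`. -/
def Q.avgNormal (q : M.Q) (e : M.Cell × M.Cell) : Pt d :=
  (1 / 2 : ℝ) • (q e.1 • M.normal e + q e.2 • M.normal e)

/-- Value at `x` of the polynomial by which a Raviart-Thomas field is given on the cell `i`. -/
def RT.val (v : M.RT) (i : M.Cell) (x : Pt d) : Pt d := (v i).1 + (v i).2 • x

/-- The normal component `v · n_e` on the interior face `e` (for fields in `H(div)` both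
neighbours give the same value). -/
def RT.flux (v : M.RT) (e : M.Cell × M.Cell) (x : Pt d) : ℝ := inner ℝ (v.val e.1 x) (M.normal e)

/-- `v ∈ U_h^0`. For a piecewise polynomial field, membership in `H(div)` means continuity of the
normal component across the interior faces. Moreover the normal component vanishes on the boundary
faces, that is, on the faces of cells that belong to no other cell. -/
structure RT.InU0 (v : M.RT) : Prop where
  normal_continuous : ∀ e ∈ M.interiorFaces, ∀ x ∈ M.face e,
    inner ℝ (v.val e.1 x) (M.normal e) = inner ℝ (v.val e.2 x) (M.normal e)
  boundary : ∀ (i : M.Cell) (s : Finset (Pt d)), s ⊆ M.cell i → s.card = d →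
    (∀ j, j ≠ i → ¬ s ⊆ M.cell j) →
    ∀ x ∈ convexHull ℝ (s : Set (Pt d)), inner ℝ (v.val i x) (outerNormal (M.cell i) s) = 0

/-- Frobenius product `A : B`. -/
def frob (A B : Matrix (Fin d) (Fin d) ℝ) : ℝ := ∑ k, ∑ l, A k l * B k l

/-- The squared norm `a ∑_K ‖c‖²_{L²(K)} + w ∑_e h_e⁻¹ ‖[c]‖²_{L²(e)}` on `Q_h`. -/
def Q.energy (a w : ℝ) (c : M.Q) : ℝ :=
  a * ∑ i, M.cellInt i (fun _ => c i ^ 2) +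
    w * ∑ e ∈ M.interiorFaces, 1 / M.hFace e * M.faceInt e (fun _ => Q.jump c e ^ 2)

end SimplicialMesh

/-! ### The model -/

/-- Physical constants of the gas and of the porous medium, apart from the Lamé parameter `γ` and
the Biot modulus `N`. -/
structure Medium where
  /-- gas constant -/
  R : ℝ
  /-- temperature -/
  T : ℝ
  /-- coefficients of the Peng-Robinson equation of state -/
  b : ℝ
  β : ℝ
  /-- Lamé parameter -/
  η : ℝ
  /-- Biot coefficient -/
  α : ℝ
  /-- viscosity of the gas -/
  ν : ℝ
  /-- initial intrinsic permeability -/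
  κ₀ : ℝ
  /-- reference porosity -/
  φr : ℝ
  R_pos : 0 < R
  T_pos : 0 < T
  β_pos : 0 < β
  η_pos : 0 < η
  α_pos : 0 < α
  α_lt_one : α < 1
  ν_pos : 0 < ν
  κ₀_pos : 0 < κ₀
  φr_pos : 0 < φr
  φr_lt_one : φr < 1

namespace Medium

variable (m : Medium)

/-- Helmholtz free energy density `f = f_ide + f_rep + f_att`. -/
def f (c : ℝ) : ℝ :=
  c * m.R * m.T * Real.log c + -(c * m.R * m.T * Real.log (1 - m.β * c)) +
    m.b * c / (2 * √2 * m.β) *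
      Real.log ((1 + (1 - √2) * m.β * c) / (1 + (1 + √2) * m.β * c))

/-- Chemical potential `μ = f'`. -/
def chem (c : ℝ) : ℝ := deriv m.f c

/-- Mobility `λ(φ) = κ(φ) / ν` with the Kozeny-Carman permeability `κ`. -/
def mobility (φ : ℝ) : ℝ := m.κ₀ * (φ / m.φr) ^ 3 * ((1 - m.φr) / (1 - φ)) ^ 2 / m.ν

end Medium

open SimplicialMesh

variable {d : ℕ} {M : SimplicialMesh d}

/-- The form `𝒜(u, p, v)`, with penalty parameter `ς₂`. -/
def formA (m : Medium) (γ ς₂ : ℝ) (u : M.V) (p : M.Q) (v : M.V) : ℝ :=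
  ∑ i, M.cellInt i (fun _ => frob (u.stress m.η γ i) (v.strain i))
    - ∑ e ∈ M.interiorFaces,
        M.faceInt e (fun x => inner ℝ (u.avgStress m.η γ e) (v.jump e x))
    - m.α * ∑ i, M.cellInt i (fun _ => p i * v.div i)
    + m.α * ∑ e ∈ M.interiorFaces,
        M.faceInt e (fun x => inner ℝ (Q.avgNormal p e) (v.jump e x))
    - ∑ e ∈ M.interiorFaces,
        M.faceInt e (fun x => inner ℝ (u.jump e x) (v.avgStress m.η γ e))
    + ∑ e ∈ M.interiorFaces,
        ς₂ / M.hFace e * M.faceInt e (fun x => inner ℝ (u.jump e x) (v.jump e x))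

/-- The discrete quantities at the time level `t_n`, with the stabilisation parameter `θ_n`. -/
structure OldLevel (M : SimplicialMesh d) where
  c : M.Q
  φ : M.Q
  p : M.Q
  us : M.V
  uf : M.RT
  θ : ℝ

/-- The upwind value of `c_h^n` on the interior face `e = (i, j)`. The normal component of a
lowest order Raviart-Thomas field is constant on a face, so its sign is read off at the
barycentre. -/
def OldLevel.upwind (o : OldLevel M) (e : M.Cell × M.Cell) : ℝ :=
  if 0 ≤ o.uf.flux e (barycentre (M.faceVerts e)) then o.c e.1 else o.c e.2

/-- The coefficient `θ_n R T / (c_h^n (1 - β c_h^n)²)` on the cell `i`. -/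
def OldLevel.stab (m : Medium) (o : OldLevel M) (i : M.Cell) : ℝ :=
  o.θ * m.R * m.T / (o.c i * (1 - m.β * o.c i) ^ 2)

/-- Standing assumptions on the quantities at the time level `t_n`: the bounds named in the result,
the boundedness of the pressure, the boundary condition on the velocity, and the discrete momentum
equation at that level. -/
structure OldLevel.Admissible (m : Medium) (γ ς₂ ϱ₀ ϱ Cφmin Cφmax Cl Cμmin Cμmax P : ℝ)
    (o : OldLevel M) : Prop where
  c_lower : ∀ i, ϱ₀ ≤ m.β * o.c i
  c_upper : ∀ i, m.β * o.c i ≤ ϱ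
  φ_lower : ∀ i, Cφmin ≤ o.φ i
  φ_upper : ∀ i, o.φ i ≤ Cφmax
  invMobility_lower : ∀ i, Cl ≤ (m.mobility (o.φ i))⁻¹
  stab_lower : ∀ i, Cμmin ≤ o.stab m i
  stab_upper : ∀ i, o.stab m i ≤ Cμmax
  p_bound : ∀ i, |o.p i| ≤ P
  uf_mem : o.uf.InU0
  momentum : ∀ v : M.V, formA m γ ς₂ o.us o.p v = 0

/-! ### The linear iteration -/

/-- The unknowns of one iterate at the new time level `t_{n+1}`. -/
structure Iterate (M : SimplicialMesh d) where
  c : M.Q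
  μ : M.Q
  p : M.Q
  φ : M.Q
  us : M.V
  uf : M.RT

/-- The equations of the scheme that involve one iterate only: the stabilised chemical potential,
the momentum equation, the Darcy law, the equation of state and the porosity equation. -/
structure Iterate.Closed (m : Medium) (γ ς₂ N τ : ℝ) (o : OldLevel M) (s : Iterate M) : Prop where
  chem : ∀ i, s.μ i = m.chem (o.c i) +
    o.θ * m.R * m.T * ((s.c i - o.c i) / (o.c i * (1 - m.β * o.c i) ^ 2))
  momentum : ∀ v : M.V, formA m γ ς₂ s.us s.p v = 0
  uf_mem : s.uf.InU0
  darcy : ∀ w : M.RT, w.InU0 →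
    ∑ i, M.cellInt i
        (fun x => (m.mobility (o.φ i))⁻¹ * inner ℝ (s.uf.val i x) (w.val i x)) =
      ∑ e ∈ M.interiorFaces,
        M.faceInt e (fun x => Q.jump s.μ e * (o.upwind e * w.flux e x))
  pressure : ∀ z : M.Q,
    ∑ i, M.cellInt i (fun _ => s.p i * z i) =
      ∑ i, M.cellInt i (fun _ => (o.c i * s.μ i - m.f (o.c i)) * z i)
  porosity : ∀ q : M.Q,
    ∑ i, M.cellInt i (fun _ => (s.φ i - o.φ i) / τ * q i) =
      1 / N * ∑ i, M.cellInt i (fun _ => (s.p i - o.p i) / τ * q i)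
      + m.α * ∑ i, M.cellInt i (fun _ => (s.us.div i - o.us.div i) / τ * q i)
      - m.α * ∑ e ∈ M.interiorFaces,
          M.faceInt e (fun x =>
            inner ℝ (Q.avgNormal q e) (τ⁻¹ • (s.us.jump e x - o.us.jump e x)))

/-- The linearised mass balance that links the iterate `s` (index `l`) to the next iterate `s'`
(index `l + 1`). -/
def massBalance (ς₁ τ : ℝ) (o : OldLevel M) (s s' : Iterate M) : Prop :=
  ∀ q : M.Q,
    ∑ i, M.cellInt i (fun _ => (s.φ i * s'.c i - o.φ i * o.c i) / τ * q i)
      + ∑ e ∈ M.interiorFaces,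
          M.faceInt e (fun x => o.upwind e * s.uf.flux e x * Q.jump q e)
      + ∑ e ∈ M.interiorFaces,
          ς₁ / M.hFace e * M.faceInt e (fun _ => Q.jump s'.μ e * Q.jump q e) = 0

/-- `c'` is the density obtained from the density `c` by one step of the iteration. -/
def IterStep (m : Medium) (γ ς₁ ς₂ N τ : ℝ) (o : OldLevel M) (c c' : M.Q) : Prop :=
  ∃ s s' : Iterate M, s.c = c ∧ s'.c = c' ∧ s.Closed m γ ς₂ N τ o ∧ s'.Closed m γ ς₂ N τ o ∧
    massBalance ς₁ τ o s s'

end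

end PoroFlow

namespace PoroFlow

noncomputable section

/-! ### Measures of elements and faces -/

/-! The step is reduced to a diffusion problem on the graph of cells. The stabilised chemical
potential `y` is, cell by cell, an affine function of the density with slope between `Cμmin` and
`Cμmax`. Since it is constant on cells, the factor `1 / h_e` of the penalty cancels against the
measure of the face, and the mass balance reads `D (y + g) + div F + ς₁ Δ y = 0`, with `Δ` the
unweighted graph Laplacian and `D > 0` diagonal. The time step enters only through `D`. The maximum
principle `graph_abs_bound` gives `|y| ≤ sup |g| + n sup |F| / ς₁` for `n` cells, whatever `D` is;
this is why nothing depends on `τ`.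

The data `g` and `F` depend on the previous density through the porosity and the Darcy flux. The
porosity equation loses its factor `1 / τ` and involves the displacement only through the discrete
divergence `V.dgDiv`, the same operator that carries the pressure in `𝒜`. For `ς₂` large the elastic
form dominates `γ ‖dgDiv u‖²` (`exists_penalty`), so testing the momentum equation with a difference
of solutions bounds porosity changes by `(1 / N + K / γ)` times pressure changes
(`exists_dgDiv_bound`). Testing Darcy's law with a difference of fluxes bounds flux changes by a
constant times changes of the potential (`RT.exists_darcy_bound`).

Hence the porosity stays above `Cφmin / 2` on the ball once `N` and `γ` are large, and the maximum
principle yields both invariance of the ball and a Lipschitz constant `k / ς₁` in the sup norm, with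
`k` independent of `ς₁`. The squared energy norm is at most a multiple of `ς₁` times the squared sup
norm, while its `L²` part controls the sup norm independently of `ς₁`. The squared norm is therefore
multiplied by at most a constant times `ς₁ (k / ς₁)² = k² / ς₁`, which is small for large `ς₁`
(`energy_contraction`). -/

lemma volume_convexHull_pos {W : Type*} [NormedAddCommGroup W] [InnerProductSpace ℝ W]
    [FiniteDimensional ℝ W] [MeasurableSpace W] [BorelSpace W] (s : Finset W)
    (hs : AffineIndependent ℝ ((↑) : s → W)) (hc : s.card = Module.finrank ℝ W + 1) :
    0 < volume.real (convexHull ℝ (s : Set W)) := by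
  have hcard : Fintype.card s = Module.finrank ℝ W + 1 := by simpa using hc
  have htop : affineSpan ℝ (s : Set W) = ⊤ := by
    have := hs.affineSpan_eq_top_iff_card_eq_finrank_add_one.2 hcard
    simpa using this
  have hint := interior_convexHull_nonempty_iff_affineSpan_eq_top.2 htop
  have hfin : volume (convexHull ℝ (s : Set W)) ≠ ⊤ :=
    (s.finite_toSet.isCompact_convexHull ℝ).measure_ne_top
  exact ENNReal.toReal_pos (Measure.measure_pos_of_nonempty_interior _ hint).ne' hfin

/-- The simplex is an isometric image of one in its own direction space, where the Hausdorff measure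
is Lebesgue measure and the full-dimensional case applies. -/
lemma euclideanHausdorffMeasure_convexHull_pos {d k : ℕ} (s : Finset (Pt d))
    (hs : AffineIndependent ℝ ((↑) : s → Pt d)) (hk : s.card = k + 1) :
    0 < ((μHE[k] : Measure (Pt d)) (convexHull ℝ (s : Set (Pt d)))).toReal := by
  classical
  obtain ⟨p, hp⟩ : s.Nonempty := by rw [← Finset.card_pos]; omega
  set W := vectorSpan ℝ (s : Set (Pt d)) with hW
  have hfr : Module.finrank ℝ W = k := by
    have := hs.finrank_vectorSpan (n := k) (by simpa using hk)
    have hr : vectorSpan ℝ (Set.range ((↑) : s → Pt d)) = W := by simp [hW]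
    rwa [hr] at this
  have hmem : ∀ x : s, (x : Pt d) - p ∈ W := fun x => vsub_mem_vectorSpan ℝ x.2 hp
  let g : s → W := fun x => ⟨(x : Pt d) - p, hmem x⟩
  have hginj : Function.Injective g := by
    intro x y hxy
    have : (x : Pt d) - p = y - p := congrArg Subtype.val hxy
    exact Subtype.ext (sub_left_injective this)
  let φ : W →ᵃ[ℝ] Pt d := W.subtype.toAffineMap + AffineMap.const ℝ W p
  have hφ : ∀ w : W, φ w = (w : Pt d) + p := fun w => rfl
  have hφg : ∀ x, φ (g x) = x := by intro x; simp [hφ, g]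
  have hgind : AffineIndependent ℝ g := by
    apply AffineIndependent.of_comp φ
    have : (φ ∘ g) = ((↑) : s → Pt d) := funext hφg
    rw [this]; exact hs
  let t : Finset W := Finset.univ.image g
  have htr : (t : Set W) = Set.range g := by simp [t]
  have htind : AffineIndependent ℝ ((↑) : t → W) := by
    have := hgind.range
    rw [← htr] at this
    exact this
  have htc : t.card = k + 1 := by
    rw [Finset.card_image_of_injective _ hginj]; simpa using hk
  have himg : convexHull ℝ (s : Set (Pt d)) = φ '' convexHull ℝ (t : Set W) := by
    rw [AffineMap.image_convexHull, htr, ← Set.range_comp]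
    congr 1
    have : (φ ∘ g) = ((↑) : s → Pt d) := funext hφg
    rw [this]; simp
  have hiso : Isometry φ := by
    refine Isometry.of_dist_eq fun x y => ?_
    simp [hφ, Subtype.dist_eq]
  rw [himg, hiso.euclideanHausdorffMeasure_image, ← hfr,
    InnerProductSpace.euclideanHausdorffMeasure_eq_volume]
  exact volume_convexHull_pos t htind (by rw [htc, hfr])

namespace SimplicialMesh

variable {d : ℕ} (M : SimplicialMesh d)

/-- Volume of an element. -/
def vol (i : M.Cell) : ℝ := volume.real (M.elem i)

lemma isCompact_elem (i : M.Cell) : IsCompact (M.elem i) :=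
  (M.cell i).finite_toSet.isCompact_convexHull ℝ

lemma isCompact_face (e : M.Cell × M.Cell) : IsCompact (M.face e) :=
  (M.faceVerts e).finite_toSet.isCompact_convexHull ℝ

lemma vol_pos (i : M.Cell) : 0 < M.vol i := by
  refine volume_convexHull_pos (M.cell i) (M.indep i) ?_
  rw [M.card_cell i]; simp

lemma interior_elem_nonempty (i : M.Cell) : (interior (M.elem i)).Nonempty := by
  refine interior_convexHull_nonempty_iff_affineSpan_eq_top.2 ?_
  have := (M.indep i).affineSpan_eq_top_iff_card_eq_finrank_add_one.2
    (by simpa using M.card_cell i)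
  simpa using this

lemma cellInt_const (i : M.Cell) (k : ℝ) : M.cellInt i (fun _ => k) = M.vol i * k := by
  simp [cellInt, vol]

variable {M}

lemma hFace_pos (hd : 0 < d) {e : M.Cell × M.Cell} (he : e ∈ M.interiorFaces) :
    0 < M.hFace e := by
  classical
  have hc : (M.faceVerts e).card = d := by
    simp only [interiorFaces, Finset.mem_filter] at he
    exact he.2.2
  refine euclideanHausdorffMeasure_convexHull_pos (M.faceVerts e) ?_ (by omega)
  have hsub : (M.faceVerts e : Set (Pt d)) ⊆ M.cell e.1 := by
    intro x hx
    simp only [faceVerts, Finset.coe_inter] at hx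
    exact hx.1
  exact (M.indep e.1).mono hsub

lemma integrableOn_face (hd : 0 < d) {e : M.Cell × M.Cell} (he : e ∈ M.interiorFaces)
    {g : Pt d → ℝ} (hg : Continuous g) :
    Integrable g ((μHE[d - 1] : Measure (Pt d)).restrict (M.face e)) := by
  -- Finiteness comes for free from `hFace_pos`: an infinite measure would have `toReal` equal to
  -- `0`.
  have hfin : (μHE[d - 1] : Measure (Pt d)) (M.face e) ≠ ⊤ := by
    have := hFace_pos hd he
    intro h
    simp [hFace, h] at this
  have : IsFiniteMeasure ((μHE[d - 1] : Measure (Pt d)).restrict (M.face e)) :=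
    ⟨by rw [Measure.restrict_apply_univ]; exact hfin.lt_top⟩
  obtain ⟨K, hK⟩ := (M.isCompact_face e).exists_bound_of_continuousOn hg.continuousOn
  refine Integrable.of_bound (C := K) hg.aestronglyMeasurable ?_
  exact (ae_restrict_iff' (M.isCompact_face e).measurableSet).2 (Filter.Eventually.of_forall hK)

lemma integrableOn_elem (i : M.Cell) {g : Pt d → ℝ} (hg : Continuous g) :
    IntegrableOn g (M.elem i) :=
  hg.continuousOn.integrableOn_compact (M.isCompact_elem i)

lemma faceInt_const (e : M.Cell × M.Cell) (k : ℝ) : M.faceInt e (fun _ => k) = M.hFace e * k := by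
  simp [faceInt, hFace, Measure.real]

lemma faceInt_add (hd : 0 < d) {e : M.Cell × M.Cell} (he : e ∈ M.interiorFaces)
    {f g : Pt d → ℝ} (hf : Continuous f) (hg : Continuous g) :
    M.faceInt e (fun x => f x + g x) = M.faceInt e f + M.faceInt e g :=
  integral_add (integrableOn_face hd he hf) (integrableOn_face hd he hg)

lemma faceInt_sub (hd : 0 < d) {e : M.Cell × M.Cell} (he : e ∈ M.interiorFaces)
    {f g : Pt d → ℝ} (hf : Continuous f) (hg : Continuous g) :
    M.faceInt e (fun x => f x - g x) = M.faceInt e f - M.faceInt e g :=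
  integral_sub (integrableOn_face hd he hf) (integrableOn_face hd he hg)

lemma faceInt_const_mul (e : M.Cell × M.Cell) (k : ℝ) (f : Pt d → ℝ) :
    M.faceInt e (fun x => k * f x) = k * M.faceInt e f :=
  integral_const_mul k f

lemma faceInt_mono (hd : 0 < d) {e : M.Cell × M.Cell} (he : e ∈ M.interiorFaces)
    {f g : Pt d → ℝ} (hf : Continuous f) (hg : Continuous g) (h : ∀ x, f x ≤ g x) :
    M.faceInt e f ≤ M.faceInt e g :=
  integral_mono (integrableOn_face hd he hf) (integrableOn_face hd he hg) h

end SimplicialMesh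

/-! ### Linear algebra of semidefinite forms -/

section Form

variable {V : Type*} [AddCommGroup V] [Module ℝ V]

lemma sq_le_mul_of_posSemidef (B : V →ₗ[ℝ] V →ₗ[ℝ] ℝ) (hsymm : ∀ v w, B v w = B w v)
    (hpos : ∀ v, 0 ≤ B v v) (v w : V) : B v w ^ 2 ≤ B v v * B w w := by
  have h : ∀ t : ℝ, 0 ≤ B v v * (t * t) + 2 * B v w * t + B w w := by
    intro t
    have := hpos (t • v + w)
    simp only [map_add, map_smul, LinearMap.add_apply, LinearMap.smul_apply, smul_eq_mul] at this
    rw [hsymm w v] at this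
    linarith
  have := discrim_le_zero h
  unfold discrim at this
  nlinarith

/-- Solvability of a symmetric problem with compatible right-hand side. -/
lemma exists_solution_of_symm [FiniteDimensional ℝ V] (B : V →ₗ[ℝ] V →ₗ[ℝ] ℝ) (hsymm : ∀ v w, B v w = B w v)
    (l : V →ₗ[ℝ] ℝ) (hl : ∀ v, B v v = 0 → l v = 0) :
    ∃ z, ∀ w, B z w = l w := by
  -- By symmetry the functionals in the range vanish on the kernel; rank-nullity turns this
  -- inclusion into an equality. The hypothesis on `l` places it in the annihilator.
  have hle : LinearMap.range B ≤ (LinearMap.ker B).dualAnnihilator := by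
    rintro _ ⟨z, rfl⟩
    rw [Submodule.mem_dualAnnihilator]
    intro w hw
    rw [hsymm, LinearMap.mem_ker.1 hw]; simp
  have hdim : Module.finrank ℝ (LinearMap.range B) =
      Module.finrank ℝ (LinearMap.ker B).dualAnnihilator := by
    have h1 := B.finrank_range_add_finrank_ker
    have h2 := Subspace.finrank_add_finrank_dualAnnihilator_eq (LinearMap.ker B)
    omega
  have heq := Submodule.eq_of_le_of_finrank_eq hle hdim
  have hmem : l ∈ LinearMap.range B := by
    rw [heq, Submodule.mem_dualAnnihilator]
    intro w hw
    apply hl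
    rw [LinearMap.mem_ker.1 hw]; simp
  obtain ⟨z, hz⟩ := hmem
  exact ⟨z, fun w => by rw [hz]⟩

/-- Represent `l` as `B z` and apply Cauchy-Schwarz; `K = B z z`. This stands in for inverse and
trace inequalities on a fixed mesh. -/
lemma exists_sq_le_mul_of_posSemidef [FiniteDimensional ℝ V] (B : V →ₗ[ℝ] V →ₗ[ℝ] ℝ) (hsymm : ∀ v w, B v w = B w v)
    (hpos : ∀ v, 0 ≤ B v v) (l : V →ₗ[ℝ] ℝ) (hl : ∀ v, B v v = 0 → l v = 0) :
    ∃ K, 0 ≤ K ∧ ∀ w, l w ^ 2 ≤ K * B w w := by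
  obtain ⟨z, hz⟩ := exists_solution_of_symm B hsymm l hl
  exact ⟨B z z, hpos z, fun w => by rw [← hz]; exact sq_le_mul_of_posSemidef B hsymm hpos z w⟩

end Form

/-! ### A maximum principle for weighted graph Laplacians -/

section Graph

variable {n : ℕ}

/-- Pigeonhole: otherwise each of the `n` disjoint layers `(G + k m, G + (k + 1) m]` contains a
value of `y`. These values use up all indices, so `y i` lies in a layer and is at most `G + n m`. -/
lemma exists_gap (y : Fin n → ℝ) (G m : ℝ) (hm : 0 ≤ m) (i : Fin n) (hi : G + n * m < y i) :
    ∃ t, G ≤ t ∧ t < y i ∧ ∀ j, t < y j → t + m < y j := by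
  classical
  by_contra! hcon
  have hlt : ∀ k : Fin n, G + (k : ℕ) * m < y i := fun k => by
    have : ((k : ℕ) : ℝ) ≤ n := by exact_mod_cast k.2.le
    nlinarith
  have hc : ∀ k : Fin n, ∃ j, G + (k : ℕ) * m < y j ∧ y j ≤ G + (k : ℕ) * m + m := fun k =>
    hcon (G + (k : ℕ) * m) (by have : (0:ℝ) ≤ (k : ℕ) * m := by positivity
                               linarith) (hlt k)
  choose j hj1 hj2 using hc
  have hinj : Function.Injective j := by
    have key : ∀ a b : Fin n, a < b → j a ≠ j b := by
      intro a b hab h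
      have h1 := hj2 a
      have h2 := hj1 b
      rw [h] at h1
      have : ((a : ℕ) : ℝ) + 1 ≤ (b : ℕ) := by exact_mod_cast hab
      nlinarith
    intro a b h
    rcases lt_trichotomy a b with hab | hab | hab
    · exact absurd h (key a b hab)
    · exact hab
    · exact absurd h.symm (key b a hab)
  obtain ⟨k, hk⟩ := (Finite.injective_iff_surjective.1 hinj) i
  have h1 := hj2 k
  rw [hk] at h1
  have : ((k : ℕ) : ℝ) + 1 ≤ n := by exact_mod_cast k.2
  nlinarith

/-- Test with the indicator of a superlevel set above which `y` has a gap of width `H / ς`. On every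
edge leaving the set the diffusive flux is then at least `H` and beats `F`, while the reaction term
is strictly positive because `y > G ≥ -g` on the set. Only the sign of `D` is used. -/
lemma graph_upper_bound (E : Finset (Fin n × Fin n)) (D g y : Fin n → ℝ) (F : Fin n × Fin n → ℝ)
    (ς G H : ℝ) (hς : 0 < ς) (hD : ∀ i, 0 < D i) (hG : ∀ i, |g i| ≤ G)
    (hH : 0 ≤ H) (hF : ∀ e ∈ E, |F e| ≤ H)
    (heq : ∀ q : Fin n → ℝ, ∑ i, D i * (y i + g i) * q i + ∑ e ∈ E, F e * (q e.1 - q e.2) +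
      ς * ∑ e ∈ E, (y e.1 - y e.2) * (q e.1 - q e.2) = 0) (i : Fin n) :
    y i ≤ G + n * (H / ς) := by
  classical
  by_contra! hi
  have hm : 0 ≤ H / ς := by positivity
  obtain ⟨t, hGt, hti, hgap⟩ := exists_gap y G (H / ς) hm i hi
  have h := heq (fun j => if t < y j then 1 else 0)
  have h1 : 0 < ∑ j, D j * (y j + g j) * (if t < y j then (1 : ℝ) else 0) := by
    have hterm : ∀ j, t < y j → 0 < D j * (y j + g j) := by
      intro j hj
      have := neg_abs_le (g j)
      exact mul_pos (hD j) (by linarith [hG j])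
    refine Finset.sum_pos' (fun j _ => ?_) ⟨i, Finset.mem_univ _, ?_⟩
    · split_ifs with hj
      · simpa using (hterm j hj).le
      · simp
    · rw [if_pos hti]; simpa using hterm i hti
  have h2 : 0 ≤ ∑ e ∈ E, F e * ((if t < y e.1 then (1 : ℝ) else 0) - if t < y e.2 then 1 else 0) +
      ς * ∑ e ∈ E, (y e.1 - y e.2) *
        ((if t < y e.1 then (1 : ℝ) else 0) - if t < y e.2 then 1 else 0) := by
    rw [Finset.mul_sum, ← Finset.sum_add_distrib]
    refine Finset.sum_nonneg fun e he => ?_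
    have hFe := abs_le.1 (hF e he)
    have hςm : ς * (H / ς) = H := by field_simp
    split_ifs with ha hb hb
    · simp
    · have := hgap _ ha
      have hd : H / ς ≤ y e.1 - y e.2 := by linarith
      have := mul_le_mul_of_nonneg_left hd hς.le
      rw [hςm] at this
      linarith
    · have := hgap _ hb
      have hd : H / ς ≤ y e.2 - y e.1 := by linarith
      have := mul_le_mul_of_nonneg_left hd hς.le
      rw [hςm] at this
      linarith
    · simp
  linarith

/-- Sup bound, uniform in the weights `D`, for the solution of a graph diffusion problem. -/
lemma graph_abs_bound (E : Finset (Fin n × Fin n)) (D g y : Fin n → ℝ) (F : Fin n × Fin n → ℝ)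
    (ς G H : ℝ) (hς : 0 < ς) (hD : ∀ i, 0 < D i) (hG : ∀ i, |g i| ≤ G)
    (hH : 0 ≤ H) (hF : ∀ e ∈ E, |F e| ≤ H)
    (heq : ∀ q : Fin n → ℝ, ∑ i, D i * (y i + g i) * q i + ∑ e ∈ E, F e * (q e.1 - q e.2) +
      ς * ∑ e ∈ E, (y e.1 - y e.2) * (q e.1 - q e.2) = 0) (i : Fin n) :
    |y i| ≤ G + n * (H / ς) := by
  refine abs_le.2 ⟨?_, graph_upper_bound E D g y F ς G H hς hD hG hH hF heq i⟩
  -- The problem is odd in `(y, g, F)`, so the lower bound is the upper bound for `-y`.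
  have := graph_upper_bound E D (-g) (-y) (-F) ς G H hς hD (by simpa using hG) hH
    (by simpa using hF) (fun q => by
      have h := heq q
      rw [← neg_eq_zero, ← h]
      simp only [Pi.neg_apply, Finset.mul_sum]
      simp only [neg_add, ← Finset.sum_neg_distrib]
      refine congrArg₂ _ (congrArg₂ _ ?_ ?_) ?_ <;>
        exact Finset.sum_congr rfl fun _ _ => by ring) i
  simp only [Pi.neg_apply] at this
  linarith

/-- Unique solvability of the graph diffusion problem for right-hand side functional `r`. -/
lemma graph_exists (E : Finset (Fin n × Fin n)) (D : Fin n → ℝ)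
    (ς : ℝ) (hς : 0 < ς) (hD : ∀ i, 0 < D i) (r : (Fin n → ℝ) →ₗ[ℝ] ℝ) :
    ∃ y : Fin n → ℝ, ∀ q : Fin n → ℝ, ∑ i, D i * y i * q i +
      ς * ∑ e ∈ E, (y e.1 - y e.2) * (q e.1 - q e.2) = r q := by
  let B : (Fin n → ℝ) →ₗ[ℝ] (Fin n → ℝ) →ₗ[ℝ] ℝ := LinearMap.mk₂ ℝ
    (fun y q => ∑ i, D i * y i * q i + ς * ∑ e ∈ E, (y e.1 - y e.2) * (q e.1 - q e.2))
    (fun a b q => by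
      simp only [Pi.add_apply, Finset.mul_sum]
      rw [add_add_add_comm, ← Finset.sum_add_distrib, ← Finset.sum_add_distrib]
      exact congrArg₂ _ (Finset.sum_congr rfl fun _ _ => by ring)
        (Finset.sum_congr rfl fun _ _ => by ring))
    (fun k a q => by
      simp only [Pi.smul_apply, smul_eq_mul, Finset.mul_sum, mul_add]
      exact congrArg₂ _ (Finset.sum_congr rfl fun _ _ => by ring)
        (Finset.sum_congr rfl fun _ _ => by ring))
    (fun q a b => by
      simp only [Pi.add_apply, Finset.mul_sum]
      rw [add_add_add_comm, ← Finset.sum_add_distrib, ← Finset.sum_add_distrib]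
      exact congrArg₂ _ (Finset.sum_congr rfl fun _ _ => by ring)
        (Finset.sum_congr rfl fun _ _ => by ring))
    (fun k q a => by
      simp only [Pi.smul_apply, smul_eq_mul, Finset.mul_sum, mul_add]
      exact congrArg₂ _ (Finset.sum_congr rfl fun _ _ => by ring)
        (Finset.sum_congr rfl fun _ _ => by ring))
  have hB : ∀ y q, B y q =
      ∑ i, D i * y i * q i + ς * ∑ e ∈ E, (y e.1 - y e.2) * (q e.1 - q e.2) := fun y q => rfl
  have hnn1 : ∀ v : Fin n → ℝ, 0 ≤ ∑ i, D i * v i * v i := fun v =>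
    Finset.sum_nonneg fun i _ => by
      rw [mul_assoc]; exact mul_nonneg (hD i).le (mul_self_nonneg _)
  have hnn2 : ∀ v : Fin n → ℝ, 0 ≤ ς * ∑ e ∈ E, (v e.1 - v e.2) * (v e.1 - v e.2) := fun v =>
    mul_nonneg hς.le (Finset.sum_nonneg fun i _ => mul_self_nonneg _)
  refine exists_solution_of_symm B ?_ r ?_
  · intro v w
    rw [hB, hB]
    simp only [Finset.mul_sum]
    exact congrArg₂ _ (Finset.sum_congr rfl fun _ _ => by ring)
        (Finset.sum_congr rfl fun _ _ => by ring)
  · intro v hv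
    rw [hB] at hv
    have h0 : ∑ i, D i * v i * v i = 0 := le_antisymm (by linarith [hnn2 v]) (hnn1 v)
    have hz : v = 0 := by
      funext i
      have := (Finset.sum_eq_zero_iff_of_nonneg (fun i _ => by
        rw [mul_assoc]; exact mul_nonneg (hD i).le (mul_self_nonneg _))).1 h0 i (Finset.mem_univ _)
      have hDi := (hD i).ne'
      simpa [hDi] using this
    rw [hz, map_zero]

end Graph

namespace SimplicialMesh

variable {d : ℕ} {M : SimplicialMesh d}

/-! ### The discontinuous Galerkin form -/

lemma exists_vol_lower (M : SimplicialMesh d) : ∃ v : ℝ, 0 < v ∧ ∀ i, v ≤ M.vol i := by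
  have hnn : ∀ i, 0 ≤ (M.vol i)⁻¹ := fun i => (inv_pos.2 (M.vol_pos i)).le
  have hpos : 0 < 1 + ∑ i, (M.vol i)⁻¹ := by
    have := Finset.sum_nonneg fun i (_ : i ∈ Finset.univ) => hnn i
    linarith
  refine ⟨(1 + ∑ i, (M.vol i)⁻¹)⁻¹, inv_pos.2 hpos, fun i => ?_⟩
  rw [inv_le_comm₀ hpos (M.vol_pos i)]
  have := Finset.single_le_sum (fun i (_ : i ∈ Finset.univ) => hnn i) (Finset.mem_univ i)
  linarith

lemma V.continuous_val (u : M.V) (i : M.Cell) : Continuous (u.val i) := by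
  unfold V.val
  refine continuous_const.add ((PiLp.continuous_toLp 2 _).comp ?_)
  exact (Continuous.matrix_mulVec continuous_const (PiLp.continuous_ofLp 2 _))

lemma V.continuous_jump (u : M.V) (e : M.Cell × M.Cell) : Continuous (u.jump e) :=
  (u.continuous_val e.1).sub (u.continuous_val e.2)

lemma V.jump_add (u v : M.V) (e : M.Cell × M.Cell) (x : Pt d) :
    V.jump (u + v) e x = u.jump e x + v.jump e x := by
  simp only [V.jump, V.val, Pi.add_apply, Prod.fst_add, Prod.snd_add, Matrix.add_mulVec,
    WithLp.toLp_add]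
  abel

lemma V.jump_smul (k : ℝ) (u : M.V) (e : M.Cell × M.Cell) (x : Pt d) :
    V.jump (k • u) e x = k • u.jump e x := by
  simp only [V.jump, V.val, Pi.smul_apply, Prod.smul_fst, Prod.smul_snd, Matrix.smul_mulVec,
    WithLp.toLp_smul, smul_sub, smul_add]

/-! ### Integrals of jumps over faces. -/

/-- Integral of the jump over a face. -/
def V.jumpInt (u : M.V) (e : M.Cell × M.Cell) : Pt d :=
  ∫ x in M.face e, u.jump e x ∂(μHE[d - 1])

/-- Integral of the product of two jumps over a face. -/
def V.jumpProd (u v : M.V) (e : M.Cell × M.Cell) : ℝ :=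
  M.faceInt e (fun x => inner ℝ (u.jump e x) (v.jump e x))

lemma V.integrable_jump (hd : 0 < d) {e : M.Cell × M.Cell} (he : e ∈ M.interiorFaces) (u : M.V) :
    Integrable (u.jump e) ((μHE[d - 1] : Measure (Pt d)).restrict (M.face e)) := by
  rw [← integrable_norm_iff (u.continuous_jump e).aestronglyMeasurable]
  exact integrableOn_face hd he (u.continuous_jump e).norm

lemma V.faceInt_inner_jump (hd : 0 < d) {e : M.Cell × M.Cell} (he : e ∈ M.interiorFaces) (u : M.V)
    (s : Pt d) : M.faceInt e (fun x => inner ℝ s (u.jump e x)) = inner ℝ s (u.jumpInt e) :=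
  integral_inner (u.integrable_jump hd he) s

lemma V.jumpInt_add (hd : 0 < d) {e : M.Cell × M.Cell} (he : e ∈ M.interiorFaces) (u v : M.V) :
    V.jumpInt (u + v) e = u.jumpInt e + v.jumpInt e := by
  unfold V.jumpInt
  simp only [V.jump_add]
  exact integral_add (u.integrable_jump hd he) (v.integrable_jump hd he)

lemma V.jumpInt_smul (k : ℝ) (u : M.V) (e : M.Cell × M.Cell) :
    V.jumpInt (k • u) e = k • u.jumpInt e := by
  unfold V.jumpInt
  simp only [V.jump_smul]
  exact integral_smul k _

lemma V.jumpProd_comm (u v : M.V) (e : M.Cell × M.Cell) : u.jumpProd v e = v.jumpProd u e := by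
  unfold V.jumpProd
  simp only [real_inner_comm]

lemma V.jumpProd_add_left (hd : 0 < d) {e : M.Cell × M.Cell} (he : e ∈ M.interiorFaces)
    (u v w : M.V) : V.jumpProd (u + v) w e = u.jumpProd w e + v.jumpProd w e := by
  unfold V.jumpProd
  simp only [V.jump_add, inner_add_left]
  exact faceInt_add hd he ((u.continuous_jump e).inner (w.continuous_jump e))
    ((v.continuous_jump e).inner (w.continuous_jump e))

lemma V.jumpProd_smul_left (k : ℝ) (u w : M.V) (e : M.Cell × M.Cell) :
    V.jumpProd (k • u) w e = k * u.jumpProd w e := by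
  unfold V.jumpProd
  simp only [V.jump_smul, real_inner_smul_left]
  exact faceInt_const_mul e k _

lemma V.norm_jumpInt_sq_le (hd : 0 < d) {e : M.Cell × M.Cell} (he : e ∈ M.interiorFaces)
    (u : M.V) : ‖u.jumpInt e‖ ^ 2 ≤ M.hFace e ^ 2 * (1 / M.hFace e * u.jumpProd u e) := by
  have hh := hFace_pos hd he
  set h := M.hFace e
  set J := u.jumpInt e
  -- Cauchy-Schwarz on the face, obtained by expanding `‖[u] - h⁻¹ J‖² ≥ 0`, where `h⁻¹ J` is the
  -- mean of the jump.
  have hmono := faceInt_mono hd he (f := fun x => 2 * h⁻¹ * inner ℝ J (u.jump e x) - h⁻¹ ^ 2 * ‖J‖ ^ 2)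
    (g := fun x => inner ℝ (u.jump e x) (u.jump e x))
    (by have := u.continuous_jump e; fun_prop)
    ((u.continuous_jump e).inner (u.continuous_jump e)) (fun x => by
      have := real_inner_self_nonneg (x := u.jump e x - h⁻¹ • J)
      rw [inner_sub_left, inner_sub_right, inner_sub_right, real_inner_smul_left,
        real_inner_smul_right, real_inner_smul_right, real_inner_smul_left,
        real_inner_self_eq_norm_sq J, real_inner_comm J (u.jump e x)] at this
      linarith)
  rw [faceInt_sub hd he (by have := u.continuous_jump e; fun_prop) (by fun_prop),
    faceInt_const_mul, V.faceInt_inner_jump hd he, faceInt_const, real_inner_self_eq_norm_sq] at hmono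
  change _ ≤ u.jumpProd u e at hmono
  change 2 * h⁻¹ * ‖J‖ ^ 2 - h * (h⁻¹ ^ 2 * ‖J‖ ^ 2) ≤ _ at hmono
  have h1 : 2 * h⁻¹ * ‖J‖ ^ 2 - h * (h⁻¹ ^ 2 * ‖J‖ ^ 2) = h⁻¹ * ‖J‖ ^ 2 := by
    field_simp; ring
  rw [h1] at hmono
  have h2 := mul_le_mul_of_nonneg_left hmono hh.le
  have h3 : h * (h⁻¹ * ‖J‖ ^ 2) = ‖J‖ ^ 2 := by field_simp
  have h4 : h ^ 2 * (1 / h * u.jumpProd u e) = h * u.jumpProd u e := by field_simp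
  rw [h4, ← h3]; exact h2

lemma V.jumpProd_self_nonneg (u : M.V) (e : M.Cell × M.Cell) : 0 ≤ u.jumpProd u e :=
  integral_nonneg fun _ => real_inner_self_nonneg

/-! Linearity of the differential operators. -/

lemma V.div_add (u v : M.V) (i : M.Cell) : V.div (u + v) i = u.div i + v.div i := by
  simp [V.div, V.grad, Matrix.trace_add]

lemma V.div_smul (k : ℝ) (u : M.V) (i : M.Cell) : V.div (k • u) i = k * u.div i := by
  simp [V.div, V.grad, Matrix.trace_smul]

lemma V.strain_add (u v : M.V) (i : M.Cell) : V.strain (u + v) i = u.strain i + v.strain i := by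
  simp only [V.strain, V.grad, Pi.add_apply, Prod.snd_add, Matrix.transpose_add, ← smul_add]
  congr 1; abel

lemma V.strain_smul (k : ℝ) (u : M.V) (i : M.Cell) : V.strain (k • u) i = k • u.strain i := by
  simp only [V.strain, V.grad, Pi.smul_apply, Prod.smul_snd, Matrix.transpose_smul, ← smul_add]
  rw [smul_comm]

lemma V.stress_add (η γ : ℝ) (u v : M.V) (i : M.Cell) :
    V.stress η γ (u + v) i = u.stress η γ i + v.stress η γ i := by
  simp only [V.stress, V.strain_add, V.div_add, mul_add, add_smul, smul_add]
  abel

lemma V.stress_smul (η γ k : ℝ) (u : M.V) (i : M.Cell) :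
    V.stress η γ (k • u) i = k • u.stress η γ i := by
  simp only [V.stress, V.strain_smul, V.div_smul, smul_add, smul_smul]
  congr 2 <;> ring

lemma V.avgStress_add (η γ : ℝ) (u v : M.V) (e : M.Cell × M.Cell) :
    V.avgStress η γ (u + v) e = u.avgStress η γ e + v.avgStress η γ e := by
  simp only [V.avgStress, V.stress_add, Matrix.add_mulVec, WithLp.toLp_add, ← smul_add]
  congr 1; abel

lemma V.avgStress_smul (η γ k : ℝ) (u : M.V) (e : M.Cell × M.Cell) :
    V.avgStress η γ (k • u) e = k • u.avgStress η γ e := by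
  simp only [V.avgStress, V.stress_smul, Matrix.smul_mulVec, WithLp.toLp_smul, ← smul_add]
  rw [smul_comm]

lemma frob_comm (A B : Matrix (Fin d) (Fin d) ℝ) : frob A B = frob B A := by
  simp only [frob, mul_comm]

lemma frob_add_left (A A' B : Matrix (Fin d) (Fin d) ℝ) :
    frob (A + A') B = frob A B + frob A' B := by
  simp only [frob, Matrix.add_apply, add_mul, Finset.sum_add_distrib]

lemma frob_smul_left (k : ℝ) (A B : Matrix (Fin d) (Fin d) ℝ) :
    frob (k • A) B = k * frob A B := by
  simp only [frob, Matrix.smul_apply, smul_eq_mul, mul_assoc, Finset.mul_sum]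

lemma frob_one_left (B : Matrix (Fin d) (Fin d) ℝ) : frob 1 B = B.trace := by
  simp [frob, Matrix.one_apply, Matrix.trace]

lemma frob_self_nonneg (A : Matrix (Fin d) (Fin d) ℝ) : 0 ≤ frob A A :=
  Finset.sum_nonneg fun _ _ => Finset.sum_nonneg fun _ _ => mul_self_nonneg _

lemma V.trace_strain (u : M.V) (i : M.Cell) : (u.strain i).trace = u.div i := by
  simp only [V.strain, V.div, Matrix.trace_smul, Matrix.trace_add, Matrix.trace_transpose,
    smul_eq_mul]
  ring

lemma V.frob_stress_strain (η γ : ℝ) (u v : M.V) (i : M.Cell) :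
    frob (u.stress η γ i) (v.strain i) =
      2 * η * frob (u.strain i) (v.strain i) + γ * (u.div i * v.div i) := by
  rw [V.stress, frob_add_left, frob_smul_left, frob_smul_left, frob_one_left, V.trace_strain]
  ring

lemma norm_mulVec_sq_le (A : Matrix (Fin d) (Fin d) ℝ) (x : Pt d) :
    ‖(WithLp.toLp 2 (A.mulVec x.ofLp) : Pt d)‖ ^ 2 ≤ frob A A * ‖x‖ ^ 2 := by
  rw [EuclideanSpace.norm_sq_eq, EuclideanSpace.norm_sq_eq, frob, Finset.sum_mul]
  refine Finset.sum_le_sum fun k _ => ?_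
  simp only [Real.norm_eq_abs, sq_abs, Matrix.mulVec, dotProduct, ← pow_two]
  exact Finset.sum_mul_sq_le_sq_mul_sq _ _ _

/-- An upper bound suffices for all estimates, so the nonvanishing of the projected vector need not
be checked: with `‖w‖⁻¹ = 0` the bound still holds. -/
lemma norm_normal_le (e : M.Cell × M.Cell) : ‖M.normal e‖ ≤ 1 := by
  unfold SimplicialMesh.normal outerNormal
  simp only [norm_smul, norm_inv, norm_norm]
  exact inv_mul_le_one

/-! ### Average strains and the lifting of normal jumps. -/

/-- The average normal strain on a face. -/
def V.avgStrain (u : M.V) (e : M.Cell × M.Cell) : Pt d :=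
  (1 / 2 : ℝ) • (WithLp.toLp 2 ((u.strain e.1).mulVec (M.normal e).ofLp) +
    WithLp.toLp 2 ((u.strain e.2).mulVec (M.normal e).ofLp))

/-- The `γ` part is normal to the face, so it sees only the normal jumps and can be absorbed into
the lifting. -/
lemma V.avgStress_eq (η γ : ℝ) (u : M.V) (e : M.Cell × M.Cell) :
    u.avgStress η γ e =
      (2 * η) • u.avgStrain e + (γ * ((u.div e.1 + u.div e.2) / 2)) • M.normal e := by
  simp only [V.avgStress, V.avgStrain, V.stress, Matrix.add_mulVec, Matrix.smul_mulVec,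
    Matrix.one_mulVec, WithLp.toLp_add, WithLp.toLp_smul, WithLp.toLp_ofLp]
  module

lemma V.norm_avgStrain_sq_le (u : M.V) (e : M.Cell × M.Cell) :
    ‖u.avgStrain e‖ ^ 2 ≤ frob (u.strain e.1) (u.strain e.1) + frob (u.strain e.2) (u.strain e.2) := by
  have h : ∀ A : Matrix (Fin d) (Fin d) ℝ,
      ‖(WithLp.toLp 2 (A.mulVec (M.normal e).ofLp) : Pt d)‖ ^ 2 ≤ frob A A := fun A => by
    refine (norm_mulVec_sq_le A _).trans (mul_le_of_le_one_right (frob_self_nonneg A) ?_)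
    exact pow_le_one₀ (norm_nonneg _) (norm_normal_le e)
  have h1 := h (u.strain e.1)
  have h2 := h (u.strain e.2)
  unfold V.avgStrain
  set a : Pt d := WithLp.toLp 2 ((u.strain e.1).mulVec (M.normal e).ofLp)
  set b : Pt d := WithLp.toLp 2 ((u.strain e.2).mulVec (M.normal e).ofLp)
  have hab := norm_add_le a b
  have : ‖(1 / 2 : ℝ) • (a + b)‖ = ‖a + b‖ / 2 := by rw [norm_smul]; norm_num; ring
  rw [this]
  nlinarith [norm_nonneg (a + b), norm_nonneg a, norm_nonneg b, sq_nonneg (‖a‖ - ‖b‖)]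

/-- Normal component of the integrated jump. -/
def V.jumpFlux (u : M.V) (e : M.Cell × M.Cell) : ℝ := inner ℝ (M.normal e) (u.jumpInt e)

/-- Lifting of the normal jumps to the cells. -/
def V.lift (u : M.V) (i : M.Cell) : ℝ :=
  (M.vol i)⁻¹ * ∑ e ∈ M.interiorFaces,
    ((if e.1 = i then 1 / 2 else 0) + (if e.2 = i then 1 / 2 else 0)) * u.jumpFlux e

/-- The discrete divergence, including the jump contributions. -/
def V.dgDiv (u : M.V) (i : M.Cell) : ℝ := u.div i - u.lift i

/-- The lifting is adjoint to averaging over faces. This turns the face terms of `𝒜` and of the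
porosity equation into cell terms. -/
lemma V.sum_vol_mul_lift (q : M.Q) (u : M.V) :
    ∑ i, M.vol i * (q i * u.lift i) =
      ∑ e ∈ M.interiorFaces, (q e.1 + q e.2) / 2 * u.jumpFlux e := by
  have h : ∀ i, M.vol i * (q i * u.lift i) = ∑ e ∈ M.interiorFaces,
      ((if e.1 = i then q i / 2 else 0) + (if e.2 = i then q i / 2 else 0)) * u.jumpFlux e := by
    intro i
    have := (M.vol_pos i).ne'
    rw [V.lift, mul_left_comm (q i), mul_inv_cancel_left₀ this, Finset.mul_sum]
    refine Finset.sum_congr rfl fun e _ => ?_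
    split_ifs <;> ring
  simp only [h]
  rw [Finset.sum_comm]
  refine Finset.sum_congr rfl fun e _ => ?_
  rw [← Finset.sum_mul, Finset.sum_add_distrib]
  simp only [Finset.sum_ite_eq, Finset.mem_univ, if_true]
  ring

lemma V.jumpFlux_add (hd : 0 < d) {e : M.Cell × M.Cell} (he : e ∈ M.interiorFaces) (u v : M.V) :
    V.jumpFlux (u + v) e = u.jumpFlux e + v.jumpFlux e := by
  simp only [V.jumpFlux, V.jumpInt_add hd he, inner_add_right]

lemma V.jumpFlux_smul (k : ℝ) (u : M.V) (e : M.Cell × M.Cell) :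
    V.jumpFlux (k • u) e = k * u.jumpFlux e := by
  simp only [V.jumpFlux, V.jumpInt_smul, real_inner_smul_right]

lemma V.lift_add (hd : 0 < d) (u v : M.V) (i : M.Cell) :
    V.lift (u + v) i = u.lift i + v.lift i := by
  simp only [V.lift]
  rw [← mul_add, ← Finset.sum_add_distrib]
  congr 1
  refine Finset.sum_congr rfl fun e he => ?_
  rw [V.jumpFlux_add hd he, mul_add]

lemma V.lift_smul (k : ℝ) (u : M.V) (i : M.Cell) : V.lift (k • u) i = k * u.lift i := by
  simp only [V.lift, V.jumpFlux_smul, Finset.mul_sum]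
  refine Finset.sum_congr rfl fun e he => ?_
  ring

lemma V.dgDiv_add (hd : 0 < d) (u v : M.V) (i : M.Cell) :
    V.dgDiv (u + v) i = u.dgDiv i + v.dgDiv i := by
  simp only [V.dgDiv, V.div_add, V.lift_add hd]; ring

lemma V.dgDiv_smul (k : ℝ) (u : M.V) (i : M.Cell) : V.dgDiv (k • u) i = k * u.dgDiv i := by
  simp only [V.dgDiv, V.div_smul, V.lift_smul]; ring

lemma V.dgDiv_sub (hd : 0 < d) (u v : M.V) (i : M.Cell) :
    V.dgDiv (u - v) i = u.dgDiv i - v.dgDiv i := by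
  have := V.dgDiv_add hd (u - v) v i
  rw [sub_add_cancel] at this
  linarith

lemma Q.avgNormal_eq (q : M.Q) (e : M.Cell × M.Cell) :
    Q.avgNormal q e = ((q e.1 + q e.2) / 2) • M.normal e := by
  unfold Q.avgNormal; module

end SimplicialMesh

/-! ### Coercivity of the elastic form and the momentum equation. -/

open SimplicialMesh
variable {d : ℕ} {M : SimplicialMesh d}

/-- The elastic part of the form `𝒜`. -/
def elasticForm (η γ ς₂ : ℝ) (u v : M.V) : ℝ :=
  ∑ i, M.vol i * frob (u.stress η γ i) (v.strain i)
    - ∑ e ∈ M.interiorFaces, inner ℝ (u.avgStress η γ e) (v.jumpInt e)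
    - ∑ e ∈ M.interiorFaces, inner ℝ (v.avgStress η γ e) (u.jumpInt e)
    + ∑ e ∈ M.interiorFaces, ς₂ * (1 / M.hFace e * u.jumpProd v e)

/-- The two pressure terms combine into one pairing with the discrete divergence, through the
lifting. -/
lemma formA_eq (hd : 0 < d) (m : Medium) (γ ς₂ : ℝ) (u : M.V) (p : M.Q) (v : M.V) :
    formA m γ ς₂ u p v = elasticForm m.η γ ς₂ u v - m.α * ∑ i, M.vol i * (p i * v.dgDiv i) := by
  have h1 : ∑ e ∈ M.interiorFaces, M.faceInt e (fun x => inner ℝ (u.avgStress m.η γ e) (v.jump e x))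
      = ∑ e ∈ M.interiorFaces, inner ℝ (u.avgStress m.η γ e) (v.jumpInt e) :=
    Finset.sum_congr rfl fun e he => V.faceInt_inner_jump hd he _ _
  have h2 : ∑ e ∈ M.interiorFaces, M.faceInt e (fun x => inner ℝ (u.jump e x) (v.avgStress m.η γ e))
      = ∑ e ∈ M.interiorFaces, inner ℝ (v.avgStress m.η γ e) (u.jumpInt e) :=
    Finset.sum_congr rfl fun e he => by
      rw [← V.faceInt_inner_jump hd he]
      simp only [real_inner_comm]
  have h3 : ∑ e ∈ M.interiorFaces, M.faceInt e (fun x => inner ℝ (Q.avgNormal p e) (v.jump e x))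
      = ∑ i, M.vol i * (p i * v.lift i) := by
    rw [V.sum_vol_mul_lift]
    refine Finset.sum_congr rfl fun e he => ?_
    rw [V.faceInt_inner_jump hd he, Q.avgNormal_eq, real_inner_smul_left, V.jumpFlux]
  have h4 : ∑ e ∈ M.interiorFaces,
        ς₂ / M.hFace e * M.faceInt e (fun x => inner ℝ (u.jump e x) (v.jump e x)) =
      ∑ e ∈ M.interiorFaces, ς₂ * (1 / M.hFace e * u.jumpProd v e) :=
    Finset.sum_congr rfl fun e he => by unfold V.jumpProd; ring
  have h5 : ∑ i, M.vol i * (p i * v.dgDiv i) =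
      ∑ i, M.vol i * (p i * v.div i) - ∑ i, M.vol i * (p i * v.lift i) := by
    rw [← Finset.sum_sub_distrib]
    exact Finset.sum_congr rfl fun i _ => by rw [V.dgDiv]; ring
  unfold formA elasticForm
  rw [h1, h2, h3, h4, h5]
  simp only [cellInt_const]
  ring

lemma elasticForm_comm (η γ ς₂ : ℝ) (u v : M.V) :
    elasticForm η γ ς₂ u v = elasticForm η γ ς₂ v u := by
  unfold elasticForm
  have h1 : ∑ i, M.vol i * frob (u.stress η γ i) (v.strain i) =
      ∑ i, M.vol i * frob (v.stress η γ i) (u.strain i) :=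
    Finset.sum_congr rfl fun i _ => by
      rw [V.frob_stress_strain, V.frob_stress_strain, frob_comm, mul_comm (u.div i)]
  simp only [h1, V.jumpProd_comm u v]
  ring

lemma elasticForm_add_left (hd : 0 < d) (η γ ς₂ : ℝ) (u v w : M.V) :
    elasticForm η γ ς₂ (u + v) w = elasticForm η γ ς₂ u w + elasticForm η γ ς₂ v w := by
  unfold elasticForm
  have h1 : ∑ e ∈ M.interiorFaces, inner ℝ (w.avgStress η γ e) (V.jumpInt (u + v) e) =
      ∑ e ∈ M.interiorFaces, inner ℝ (w.avgStress η γ e) (u.jumpInt e) +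
      ∑ e ∈ M.interiorFaces, inner ℝ (w.avgStress η γ e) (v.jumpInt e) := by
    rw [← Finset.sum_add_distrib]
    exact Finset.sum_congr rfl fun e he => by rw [V.jumpInt_add hd he, inner_add_right]
  have h2 : ∑ e ∈ M.interiorFaces, ς₂ * (1 / M.hFace e * V.jumpProd (u + v) w e) =
      ∑ e ∈ M.interiorFaces, ς₂ * (1 / M.hFace e * V.jumpProd u w e) +
      ∑ e ∈ M.interiorFaces, ς₂ * (1 / M.hFace e * V.jumpProd v w e) := by
    rw [← Finset.sum_add_distrib]
    exact Finset.sum_congr rfl fun e he => by rw [V.jumpProd_add_left hd he]; ring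
  rw [h1, h2]
  simp only [V.stress_add, frob_add_left, V.avgStress_add, inner_add_left, mul_add,
    Finset.sum_add_distrib]
  ring

lemma elasticForm_smul_left (η γ ς₂ k : ℝ) (u w : M.V) :
    elasticForm η γ ς₂ (k • u) w = k * elasticForm η γ ς₂ u w := by
  unfold elasticForm
  simp only [V.stress_smul, frob_smul_left, V.avgStress_smul, real_inner_smul_left,
    V.jumpInt_smul, real_inner_smul_right, V.jumpProd_smul_left, mul_add, mul_sub, Finset.mul_sum]
  congr 1
  · congr 2
    exact Finset.sum_congr rfl fun _ _ => by ring
  · exact Finset.sum_congr rfl fun _ _ => by ring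

/-- The elastic part of `𝒜` as a bilinear map. -/
def elasticBilin (hd : 0 < d) (η γ ς₂ : ℝ) : M.V →ₗ[ℝ] M.V →ₗ[ℝ] ℝ :=
  LinearMap.mk₂ ℝ (elasticForm η γ ς₂) (elasticForm_add_left hd η γ ς₂)
    (elasticForm_smul_left η γ ς₂)
    (fun u v w => by
      rw [elasticForm_comm, elasticForm_add_left hd, elasticForm_comm _ _ _ v,
        elasticForm_comm _ _ _ w])
    (fun k u v => by rw [elasticForm_comm, elasticForm_smul_left, elasticForm_comm]; rfl)

/-- Completing the square in the `γ` terms: `div² - 2 div lift = dgDiv² - lift²`. The negative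
remainder contains jumps only, so the penalty can absorb it. -/
lemma elasticForm_self (η γ ς₂ : ℝ) (u : M.V) :
    elasticForm η γ ς₂ u u =
      2 * η * ∑ i, M.vol i * frob (u.strain i) (u.strain i)
      - 4 * η * ∑ e ∈ M.interiorFaces, inner ℝ (u.avgStrain e) (u.jumpInt e)
      + γ * (∑ i, M.vol i * u.dgDiv i ^ 2 - ∑ i, M.vol i * u.lift i ^ 2)
      + ς₂ * ∑ e ∈ M.interiorFaces, 1 / M.hFace e * u.jumpProd u e := by
  have h1 : ∑ e ∈ M.interiorFaces, inner ℝ (u.avgStress η γ e) (u.jumpInt e) =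
      2 * η * ∑ e ∈ M.interiorFaces, inner ℝ (u.avgStrain e) (u.jumpInt e) +
      γ * ∑ i, M.vol i * (u.div i * u.lift i) := by
    rw [V.sum_vol_mul_lift (fun i => u.div i), Finset.mul_sum, Finset.mul_sum,
      ← Finset.sum_add_distrib]
    refine Finset.sum_congr rfl fun e _ => ?_
    rw [V.avgStress_eq, inner_add_left, real_inner_smul_left, real_inner_smul_left, V.jumpFlux]
    ring
  have h2 : ∑ i, M.vol i * u.dgDiv i ^ 2 = ∑ i, M.vol i * (u.div i * u.div i)
      - 2 * ∑ i, M.vol i * (u.div i * u.lift i) + ∑ i, M.vol i * u.lift i ^ 2 := by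
    rw [Finset.mul_sum, ← Finset.sum_sub_distrib, ← Finset.sum_add_distrib]
    exact Finset.sum_congr rfl fun i _ => by rw [V.dgDiv]; ring
  have h3 : ∑ i, M.vol i * frob (u.stress η γ i) (u.strain i) =
      2 * η * ∑ i, M.vol i * frob (u.strain i) (u.strain i) +
      γ * ∑ i, M.vol i * (u.div i * u.div i) := by
    rw [Finset.mul_sum, Finset.mul_sum, ← Finset.sum_add_distrib]
    exact Finset.sum_congr rfl fun i _ => by rw [V.frob_stress_strain]; ring
  unfold elasticForm
  rw [h1, h2, h3, ← Finset.mul_sum]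
  ring

/-- A crude discrete trace inequality: strains are constant on cells, so each face value is bounded
by the sum over all cells. The `+ 1` keeps the denominator positive when there are no interior
faces. -/
lemma sum_strain_face_le (u : M.V) {v : ℝ} (hv : 0 < v) (hvol : ∀ i, v ≤ M.vol i) :
    (v / (2 * M.interiorFaces.card + 1)) * ∑ e ∈ M.interiorFaces, ‖u.avgStrain e‖ ^ 2 ≤
      ∑ i, M.vol i * frob (u.strain i) (u.strain i) := by
  set S := ∑ i, frob (u.strain i) (u.strain i)
  have hS : ∀ i, frob (u.strain i) (u.strain i) ≤ S := fun i =>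
    Finset.single_le_sum (fun i (_ : i ∈ Finset.univ) => frob_self_nonneg (u.strain i))
      (Finset.mem_univ i)
  have hS0 : 0 ≤ S := Finset.sum_nonneg fun i _ => frob_self_nonneg _
  have h1 : ∑ e ∈ M.interiorFaces, ‖u.avgStrain e‖ ^ 2 ≤ M.interiorFaces.card * (2 * S) := by
    rw [← nsmul_eq_mul]
    refine Finset.sum_le_card_nsmul _ _ _ fun e _ => ?_
    linarith [u.norm_avgStrain_sq_le e, hS e.1, hS e.2]
  have h2 : v * S ≤ ∑ i, M.vol i * frob (u.strain i) (u.strain i) := by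
    rw [Finset.mul_sum]
    exact Finset.sum_le_sum fun i _ => mul_le_mul_of_nonneg_right (hvol i) (frob_self_nonneg _)
  refine le_trans ?_ h2
  have hc : (0 : ℝ) < 2 * M.interiorFaces.card + 1 := by positivity
  rw [div_mul_eq_mul_div, div_le_iff₀ hc, mul_assoc]
  refine mul_le_mul_of_nonneg_left ?_ hv.le
  nlinarith

lemma sum_vol_lift_sq_le (u : M.V) {v : ℝ} (hv : 0 < v) (hvol : ∀ i, v ≤ M.vol i) :
    ∑ i, M.vol i * u.lift i ^ 2 ≤
      M.numCells * (v⁻¹ * (M.interiorFaces.card * ∑ e ∈ M.interiorFaces, ‖u.jumpInt e‖ ^ 2)) := by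
  have h : ∀ i ∈ (Finset.univ : Finset M.Cell), M.vol i * u.lift i ^ 2 ≤
      v⁻¹ * (M.interiorFaces.card * ∑ e ∈ M.interiorFaces, ‖u.jumpInt e‖ ^ 2) := by
    intro i _
    have hvi := M.vol_pos i
    have h1 : M.vol i * u.lift i ^ 2 = (M.vol i)⁻¹ * (∑ e ∈ M.interiorFaces,
        ((if e.1 = i then 1 / 2 else 0) + (if e.2 = i then 1 / 2 else 0)) * u.jumpFlux e) ^ 2 := by
      rw [V.lift]; field_simp
    rw [h1]
    refine mul_le_mul (inv_anti₀ hv (hvol i)) ?_ (sq_nonneg _) (inv_pos.2 hv).le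
    refine (sq_sum_le_card_mul_sum_sq).trans ?_
    refine mul_le_mul_of_nonneg_left (Finset.sum_le_sum fun e _ => ?_) (Nat.cast_nonneg _)
    have h2 : |u.jumpFlux e| ≤ ‖u.jumpInt e‖ := by
      refine (abs_real_inner_le_norm _ _).trans ?_
      exact mul_le_of_le_one_left (norm_nonneg _) (norm_normal_le e)
    rw [mul_pow]
    have h3 : u.jumpFlux e ^ 2 ≤ ‖u.jumpInt e‖ ^ 2 := sq_le_sq' (by linarith [abs_le.1 h2]) (abs_le.1 h2).2
    refine (mul_le_of_le_one_left (sq_nonneg _) ?_).trans h3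
    split_ifs <;> norm_num
  have := Finset.sum_le_card_nsmul _ _ _ h
  simpa [nsmul_eq_mul] using this

/-- For a large jump penalty the elastic form controls the discrete divergence. -/
lemma exists_penalty (hd : 0 < d) (M : SimplicialMesh d) {η γ : ℝ} (hη : 0 < η) (hγ : 0 < γ) :
    ∃ ς₂₀ : ℝ, ∀ ς₂ ≥ ς₂₀, ∀ u : M.V,
      γ * ∑ i, M.vol i * u.dgDiv i ^ 2 ≤ elasticForm η γ ς₂ u u := by
  obtain ⟨v, hv, hvol⟩ := M.exists_vol_lower
  set δ := v / (2 * M.interiorFaces.card + 1) with hδ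
  have hδ0 : 0 < δ := by positivity
  set H := ∑ e ∈ M.interiorFaces, M.hFace e ^ 2
  set κ := γ * (M.numCells * (v⁻¹ * M.interiorFaces.card)) with hκ
  have hκ0 : 0 ≤ κ := by positivity
  -- `2 * η / δ` pays for the strain-jump term after Young's inequality, `κ` for the squared
  -- lifting, and `H` converts integrated jumps into the penalty sum.
  refine ⟨(2 * η / δ + κ) * H, fun ς₂ hς u => ?_⟩
  rw [elasticForm_self]
  set G := ∑ e ∈ M.interiorFaces, 1 / M.hFace e * u.jumpProd u e with hG
  have hterm : ∀ e ∈ M.interiorFaces, 0 ≤ 1 / M.hFace e * u.jumpProd u e := fun e he =>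
    mul_nonneg (one_div_nonneg.2 (hFace_pos hd he).le) (u.jumpProd_self_nonneg e)
  have hG0 : 0 ≤ G := Finset.sum_nonneg hterm
  have hJ : ∑ e ∈ M.interiorFaces, ‖u.jumpInt e‖ ^ 2 ≤ H * G := by
    rw [hG, Finset.mul_sum]
    refine Finset.sum_le_sum fun e he => (u.norm_jumpInt_sq_le hd he).trans ?_
    refine mul_le_mul_of_nonneg_right ?_ (hterm e he)
    exact Finset.single_le_sum (f := fun e => M.hFace e ^ 2) (fun e _ => sq_nonneg _) he
  have hstrain := sum_strain_face_le u hv hvol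
  have hlift := sum_vol_lift_sq_le u hv hvol
  rw [← hδ] at hstrain
  set J := ∑ e ∈ M.interiorFaces, ‖u.jumpInt e‖ ^ 2
  set A := ∑ e ∈ M.interiorFaces, ‖u.avgStrain e‖ ^ 2 with hA
  -- Young's inequality with the weight `δ` for which `δ * A` is absorbed by the strain energy.
  have hY : 2 * ∑ e ∈ M.interiorFaces, inner ℝ (u.avgStrain e) (u.jumpInt e) ≤ δ * A + δ⁻¹ * J := by
    rw [hA, Finset.mul_sum, Finset.mul_sum, Finset.mul_sum, ← Finset.sum_add_distrib]
    refine Finset.sum_le_sum fun e _ => ?_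
    have h1 := real_inner_le_norm (u.avgStrain e) (u.jumpInt e)
    have h2 : 0 ≤ δ⁻¹ * (δ * ‖u.avgStrain e‖ - ‖u.jumpInt e‖) ^ 2 := by positivity
    have h3 : δ⁻¹ * (δ * ‖u.avgStrain e‖ - ‖u.jumpInt e‖) ^ 2 =
        δ * ‖u.avgStrain e‖ ^ 2 + δ⁻¹ * ‖u.jumpInt e‖ ^ 2
          - 2 * (‖u.avgStrain e‖ * ‖u.jumpInt e‖) := by
      field_simp; ring
    linarith
  have h1 : 2 * η * (2 * ∑ e ∈ M.interiorFaces, inner ℝ (u.avgStrain e) (u.jumpInt e)) ≤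
      2 * η * (∑ i, M.vol i * frob (u.strain i) (u.strain i) + δ⁻¹ * J) :=
    mul_le_mul_of_nonneg_left (by linarith) (by positivity)
  have h2 : γ * ∑ i, M.vol i * u.lift i ^ 2 ≤ κ * J := by
    refine (mul_le_mul_of_nonneg_left hlift hγ.le).trans (le_of_eq ?_)
    rw [hκ]; ring
  have h3 : (2 * η / δ + κ) * J ≤ ς₂ * G := by
    calc (2 * η / δ + κ) * J ≤ (2 * η / δ + κ) * (H * G) :=
          mul_le_mul_of_nonneg_left hJ (by positivity)
      _ = ((2 * η / δ + κ) * H) * G := by ring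
      _ ≤ ς₂ * G := mul_le_mul_of_nonneg_right hς hG0
  have h4 : (2 * η / δ + κ) * J = 2 * η * (δ⁻¹ * J) + κ * J := by ring
  linarith

/-- Solvability of the discrete momentum equation. -/
lemma exists_momentum (hd : 0 < d) (m : Medium) {γ ς₂ : ℝ} (hγ : 0 < γ)
    (hco : ∀ u : M.V, γ * ∑ i, M.vol i * u.dgDiv i ^ 2 ≤ elasticForm m.η γ ς₂ u u) (p : M.Q) :
    ∃ u : M.V, ∀ v : M.V, formA m γ ς₂ u p v = 0 := by
  let l : M.V →ₗ[ℝ] ℝ :=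
    { toFun := fun v => m.α * ∑ i, M.vol i * (p i * v.dgDiv i)
      map_add' := fun u v => by
        simp only [V.dgDiv_add hd, mul_add, Finset.sum_add_distrib]
      map_smul' := fun k u => by
        simp only [V.dgDiv_smul, RingHom.id_apply, smul_eq_mul, Finset.mul_sum]
        exact Finset.sum_congr rfl fun _ _ => by ring }
  obtain ⟨u, hu⟩ := exists_solution_of_symm (elasticBilin (M := M) hd m.η γ ς₂)
    (elasticForm_comm m.η γ ς₂) l (fun v hv => by
      -- Compatibility: coercivity makes the discrete divergence vanish wherever the form does, and
      -- the load sees nothing else. The displacement itself need not be unique (global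
      -- translations), but its discrete divergence is.
      have h0 : ∑ i, M.vol i * v.dgDiv i ^ 2 ≤ 0 := by
        have := hco v
        change elasticForm m.η γ ς₂ v v = 0 at hv
        rw [hv] at this
        exact nonpos_of_mul_nonpos_right this hγ
      have hnn : ∀ i ∈ (Finset.univ : Finset M.Cell), 0 ≤ M.vol i * v.dgDiv i ^ 2 := fun i _ =>
        mul_nonneg (M.vol_pos i).le (sq_nonneg _)
      have hz := (Finset.sum_eq_zero_iff_of_nonneg hnn).1
        (le_antisymm h0 (Finset.sum_nonneg hnn))
      change m.α * ∑ i, M.vol i * (p i * v.dgDiv i) = 0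
      rw [Finset.sum_eq_zero, mul_zero]
      intro i hi
      have := hz i hi
      have hvi := (M.vol_pos i).ne'
      simp only [mul_eq_zero, hvi, false_or, pow_eq_zero_iff, ne_eq, OfNat.ofNat_ne_zero,
        not_false_eq_true] at this
      rw [this]; ring)
  exact ⟨u, fun v => by rw [formA_eq hd, sub_eq_zero]; exact hu v⟩

/-- Test the difference of two momentum equations with the difference `w` of the solutions: `γ
‖dgDiv w‖² ≤ α (p - p', dgDiv w)`, which gains the factor `1 / γ` uniformly in `ς₂`. -/
lemma exists_dgDiv_bound (hd : 0 < d) (M : SimplicialMesh d) :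
    ∃ K : ℝ, 0 < K ∧ ∀ (m : Medium) (γ ς₂ : ℝ), 0 < γ →
      (∀ u : M.V, γ * ∑ i, M.vol i * u.dgDiv i ^ 2 ≤ elasticForm m.η γ ς₂ u u) →
      ∀ (u u' : M.V) (p p' : M.Q), (∀ v, formA m γ ς₂ u p v = 0) →
        (∀ v, formA m γ ς₂ u' p' v = 0) →
        ∀ r : ℝ, (∀ i, |p i - p' i| ≤ r) → ∀ i, |u.dgDiv i - u'.dgDiv i| ≤ K / γ * r := by
  obtain ⟨v, hv, hvol⟩ := M.exists_vol_lower
  set T := ∑ i, M.vol i with hT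
  have hT0 : 0 ≤ T := Finset.sum_nonneg fun i _ => (M.vol_pos i).le
  -- Passing from the `L²` to the sup norm costs `T / v` in the square; `T / v ≤ (T / v + 1) ^ 2`
  -- avoids a square root.
  refine ⟨T / v + 1, by positivity, ?_⟩
  intro m γ ς₂ hγ hco u u' p p' hu hu' r hr i
  have hr0 : 0 ≤ r := (abs_nonneg _).trans (hr i)
  set w := u - u' with hw
  have hform : elasticForm m.η γ ς₂ w w = m.α * ∑ i, M.vol i * ((p i - p' i) * w.dgDiv i) := by
    have h1 := hu w
    have h2 := hu' w
    rw [formA_eq hd, sub_eq_zero] at h1 h2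
    have h3 := elasticForm_add_left hd m.η γ ς₂ w u' w
    rw [hw, sub_add_cancel, ← hw, h1, h2] at h3
    have h4 : ∑ i, M.vol i * ((p i - p' i) * w.dgDiv i) =
        ∑ i, M.vol i * (p i * w.dgDiv i) - ∑ i, M.vol i * (p' i * w.dgDiv i) := by
      rw [← Finset.sum_sub_distrib]
      exact Finset.sum_congr rfl fun _ _ => by ring
    rw [h4]; linarith
  have hmain : γ ^ 2 * ∑ i, M.vol i * w.dgDiv i ^ 2 ≤ r ^ 2 * T := by
    have hco' := hco w
    rw [hform] at hco'
    have hY : ∀ i, 2 * m.α * γ * (M.vol i * ((p i - p' i) * w.dgDiv i)) ≤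
        M.vol i * (γ ^ 2 * w.dgDiv i ^ 2) + M.vol i * r ^ 2 := by
      intro i
      rw [← mul_add]
      have : 2 * m.α * γ * (M.vol i * ((p i - p' i) * w.dgDiv i)) =
        M.vol i * (2 * (m.α * (p i - p' i)) * (γ * w.dgDiv i)) := by ring
      rw [this]
      refine mul_le_mul_of_nonneg_left ?_ (M.vol_pos i).le
      have h1 : (m.α * (p i - p' i)) ^ 2 ≤ r ^ 2 := by
        rw [mul_pow]
        have h2 : (p i - p' i) ^ 2 ≤ r ^ 2 := sq_le_sq' (by linarith [abs_le.1 (hr i)]) (abs_le.1 (hr i)).2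
        refine (mul_le_of_le_one_left (sq_nonneg _) ?_).trans h2
        exact pow_le_one₀ m.α_pos.le m.α_lt_one.le
      nlinarith [sq_nonneg (m.α * (p i - p' i) - γ * w.dgDiv i)]
    have hs := Finset.sum_le_sum fun i (_ : i ∈ Finset.univ) => hY i
    rw [← Finset.mul_sum, Finset.sum_add_distrib, ← Finset.sum_mul] at hs
    have h5 : ∑ i, M.vol i * (γ ^ 2 * w.dgDiv i ^ 2) = γ ^ 2 * ∑ i, M.vol i * w.dgDiv i ^ 2 := by
      rw [Finset.mul_sum]; exact Finset.sum_congr rfl fun _ _ => by ring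
    rw [h5, ← hT] at hs
    have h6 := mul_le_mul_of_nonneg_left hco' (by positivity : 0 ≤ 2 * γ)
    nlinarith
  have hi : v * w.dgDiv i ^ 2 ≤ ∑ i, M.vol i * w.dgDiv i ^ 2 :=
    (mul_le_mul_of_nonneg_right (hvol i) (sq_nonneg _)).trans
      (Finset.single_le_sum (f := fun i => M.vol i * w.dgDiv i ^ 2)
        (fun i _ => mul_nonneg (M.vol_pos i).le (sq_nonneg _)) (Finset.mem_univ i))
  rw [← V.dgDiv_sub hd, ← hw]
  have hsq : (γ * w.dgDiv i) ^ 2 ≤ ((T / v + 1) * r) ^ 2 := by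
    have h7 : v * (γ * w.dgDiv i) ^ 2 ≤ v * (T / v * r ^ 2) := by
      have : v * (T / v * r ^ 2) = r ^ 2 * T := by field_simp
      rw [this]
      refine le_trans ?_ hmain
      rw [mul_pow, mul_left_comm]
      exact mul_le_mul_of_nonneg_left hi (sq_nonneg _)
    have h8 := le_of_mul_le_mul_left h7 hv
    refine h8.trans ?_
    rw [mul_pow]
    refine mul_le_mul_of_nonneg_right ?_ (sq_nonneg _)
    have : 0 ≤ T / v := by positivity
    nlinarith
  have h9 := abs_le_of_sq_le_sq hsq (by positivity)
  rw [abs_mul, abs_of_pos hγ] at h9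
  rw [div_mul_eq_mul_div, le_div_iff₀ hγ, mul_comm]
  exact h9

namespace SimplicialMesh

/-! ### Darcy's law in the Raviart-Thomas space -/

lemma RT.continuous_val (v : M.RT) (i : M.Cell) : Continuous (v.val i) := by
  unfold RT.val; fun_prop

lemma RT.continuous_flux (v : M.RT) (e : M.Cell × M.Cell) : Continuous (v.flux e) :=
  (v.continuous_val e.1).inner continuous_const

lemma RT.val_add (v w : M.RT) (i : M.Cell) (x : Pt d) :
    RT.val (v + w) i x = v.val i x + w.val i x := by
  simp only [RT.val, Pi.add_apply, Prod.fst_add, Prod.snd_add, add_smul]; abel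

lemma RT.val_smul (k : ℝ) (v : M.RT) (i : M.Cell) (x : Pt d) :
    RT.val (k • v) i x = k • v.val i x := by
  simp only [RT.val, Pi.smul_apply, Prod.smul_fst, Prod.smul_snd, smul_add, smul_eq_mul, mul_smul]

lemma RT.val_zero (i : M.Cell) (x : Pt d) : RT.val (0 : M.RT) i x = 0 := by
  simp [RT.val]

variable (M) in
/-- The space `U_h^0` as a submodule. -/
def fluxSpace : Submodule ℝ M.RT where
  carrier := {v | v.InU0}
  zero_mem' :=
    { normal_continuous := fun e _ x _ => by rw [RT.val_zero, RT.val_zero]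
      boundary := fun i s _ _ _ x _ => by rw [RT.val_zero, inner_zero_left] }
  add_mem' := fun {v w} hv hw =>
    { normal_continuous := fun e he x hx => by
        simp only [RT.val_add, inner_add_left, hv.normal_continuous e he x hx,
          hw.normal_continuous e he x hx]
      boundary := fun i s h1 h2 h3 x hx => by
        rw [RT.val_add, inner_add_left, hv.boundary i s h1 h2 h3 x hx,
          hw.boundary i s h1 h2 h3 x hx, add_zero] }
  smul_mem' := fun k v hv =>
    { normal_continuous := fun e he x hx => by
        simp only [RT.val_smul, real_inner_smul_left, hv.normal_continuous e he x hx]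
      boundary := fun i s h1 h2 h3 x hx => by
        rw [RT.val_smul, real_inner_smul_left, hv.boundary i s h1 h2 h3 x hx, mul_zero] }

/-- Integral of the normal component over a face. -/
def RT.fluxInt (v : M.RT) (e : M.Cell × M.Cell) : ℝ := M.faceInt e (v.flux e)

lemma RT.fluxInt_add (hd : 0 < d) {e : M.Cell × M.Cell} (he : e ∈ M.interiorFaces) (v w : M.RT) :
    RT.fluxInt (v + w) e = v.fluxInt e + w.fluxInt e := by
  have : RT.flux (v + w) e = fun x => v.flux e x + w.flux e x := by
    funext x; simp only [RT.flux, RT.val_add, inner_add_left]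
  rw [RT.fluxInt, this]
  exact faceInt_add hd he (v.continuous_flux e) (w.continuous_flux e)

lemma RT.fluxInt_smul (k : ℝ) (v : M.RT) (e : M.Cell × M.Cell) :
    RT.fluxInt (k • v) e = k * v.fluxInt e := by
  have : RT.flux (k • v) e = fun x => k * v.flux e x := by
    funext x; simp only [RT.flux, RT.val_smul, real_inner_smul_left]
  rw [RT.fluxInt, this]
  exact faceInt_const_mul e k _

/-- The weighted mass form on Raviart-Thomas fields. -/
def RT.mass (l : M.Cell → ℝ) (v w : M.RT) : ℝ :=
  ∑ i, M.cellInt i (fun x => l i * inner ℝ (v.val i x) (w.val i x))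

lemma RT.integrable_inner (v w : M.RT) (i : M.Cell) :
    IntegrableOn (fun x => inner ℝ (v.val i x) (w.val i x) : Pt d → ℝ) (M.elem i) :=
  integrableOn_elem i ((v.continuous_val i).inner (w.continuous_val i))

lemma RT.mass_eq (l : M.Cell → ℝ) (v w : M.RT) :
    RT.mass l v w = ∑ i, l i * M.cellInt i (fun x => inner ℝ (v.val i x) (w.val i x)) :=
  Finset.sum_congr rfl fun _ _ => integral_const_mul _ _

lemma RT.mass_comm (l : M.Cell → ℝ) (v w : M.RT) : RT.mass l v w = RT.mass l w v := by
  unfold RT.mass; simp only [real_inner_comm]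

lemma RT.mass_add_left (l : M.Cell → ℝ) (u v w : M.RT) :
    RT.mass l (u + v) w = RT.mass l u w + RT.mass l v w := by
  simp only [RT.mass_eq, RT.val_add, inner_add_left]
  rw [← Finset.sum_add_distrib]
  refine Finset.sum_congr rfl fun i _ => ?_
  rw [← mul_add]
  congr 1
  exact integral_add (RT.integrable_inner u w i) (RT.integrable_inner v w i)

lemma RT.mass_smul_left (l : M.Cell → ℝ) (k : ℝ) (v w : M.RT) :
    RT.mass l (k • v) w = k * RT.mass l v w := by
  simp only [RT.mass_eq, RT.val_smul, real_inner_smul_left, Finset.mul_sum]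
  refine Finset.sum_congr rfl fun i _ => ?_
  rw [mul_left_comm]
  congr 1
  exact integral_const_mul _ _

/-- The weighted mass form as a bilinear map. -/
def RT.massBilin (l : M.Cell → ℝ) : M.RT →ₗ[ℝ] M.RT →ₗ[ℝ] ℝ :=
  LinearMap.mk₂ ℝ (RT.mass l) (RT.mass_add_left l) (RT.mass_smul_left l)
    (fun u v w => by
      rw [RT.mass_comm, RT.mass_add_left, RT.mass_comm l v, RT.mass_comm l w])
    (fun k u v => by rw [RT.mass_comm, RT.mass_smul_left, RT.mass_comm]; rfl)

lemma RT.cellMass_nonneg (v : M.RT) (i : M.Cell) :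
    0 ≤ M.cellInt i (fun x => inner ℝ (v.val i x) (v.val i x)) :=
  integral_nonneg fun _ => real_inner_self_nonneg

/-- By continuity the polynomial vanishes on the interior of the cell; its values at two distinct
points there determine both coefficients. -/
lemma RT.eq_zero_of_cellMass (hd : 0 < d) (v : M.RT) (i : M.Cell)
    (h : M.cellInt i (fun x => inner ℝ (v.val i x) (v.val i x)) = 0) : v i = 0 := by
  have hcont : Continuous (fun x => inner ℝ (v.val i x) (v.val i x) : Pt d → ℝ) :=
    (v.continuous_val i).inner (v.continuous_val i)
  have hae := (setIntegral_eq_zero_iff_of_nonneg_ae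
    (Filter.Eventually.of_forall fun _ => real_inner_self_nonneg) (RT.integrable_inner v v i)).1 h
  have hae' : (fun x => inner ℝ (v.val i x) (v.val i x) : Pt d → ℝ)
      =ᵐ[volume.restrict (interior (M.elem i))] fun _ => (0 : ℝ) :=
    ae_restrict_of_ae_restrict_of_subset interior_subset hae
  have heq := Measure.eqOn_open_of_ae_eq hae' isOpen_interior hcont.continuousOn
    continuousOn_const
  have hval : ∀ x ∈ interior (M.elem i), v.val i x = 0 := fun x hx =>
    inner_self_eq_zero.1 (heq hx)
  obtain ⟨x₀, hx₀⟩ := M.interior_elem_nonempty i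
  obtain ⟨ε, hε, hball⟩ := Metric.isOpen_iff.1 isOpen_interior x₀ hx₀
  have h0 := hval x₀ hx₀
  let w : Pt d := (ε / 2) • EuclideanSpace.single (⟨0, hd⟩ : Fin d) (1 : ℝ)
  have hw : ‖w‖ = ε / 2 := by
    simp only [w, norm_smul, PiLp.norm_single, norm_one, mul_one, Real.norm_eq_abs]
    exact abs_of_pos (by positivity)
  have h1 := hval (x₀ + w) (hball (by
    rw [Metric.mem_ball, dist_eq_norm, add_sub_cancel_left, hw]; linarith))
  have hw0 : w ≠ 0 := by rw [← norm_pos_iff, hw]; positivity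
  simp only [RT.val, smul_add] at h0 h1
  rw [← add_assoc, h0, zero_add, smul_eq_zero, or_iff_left hw0] at h1
  rw [h1, zero_smul, add_zero] at h0
  exact Prod.ext h0 h1

lemma RT.mass_self_nonneg {l : M.Cell → ℝ} (hl : ∀ i, 0 ≤ l i) (v : M.RT) :
    0 ≤ RT.mass l v v := by
  rw [RT.mass_eq]
  exact Finset.sum_nonneg fun i _ => mul_nonneg (hl i) (v.cellMass_nonneg i)

lemma RT.eq_zero_of_mass (hd : 0 < d) {l : M.Cell → ℝ} (hl : ∀ i, 0 < l i) {v : M.RT}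
    (h : RT.mass l v v = 0) : v = 0 := by
  rw [RT.mass_eq] at h
  have hz := (Finset.sum_eq_zero_iff_of_nonneg fun i _ =>
    mul_nonneg (hl i).le (v.cellMass_nonneg i)).1 h
  funext i
  refine v.eq_zero_of_cellMass hd i ?_
  have := hz i (Finset.mem_univ i)
  rwa [mul_eq_zero, or_iff_right (hl i).ne'] at this

/-- The mass form is positive definite in finite dimension, hence bounds every linear functional.
The constants of the faces are summed to obtain a single one. -/
lemma RT.exists_fluxInt_sq_le (hd : 0 < d) (M : SimplicialMesh d) :
    ∃ K : ℝ, 0 ≤ K ∧ ∀ e ∈ M.interiorFaces, ∀ v : M.RT,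
      v.fluxInt e ^ 2 ≤ K * RT.mass (fun _ => 1) v v := by
  have h : ∀ e : M.interiorFaces, ∃ K : ℝ, 0 ≤ K ∧ ∀ v : M.RT,
      v.fluxInt e ^ 2 ≤ K * RT.mass (fun _ => 1) v v := fun e => by
    let r : M.RT →ₗ[ℝ] ℝ :=
      { toFun := fun v => v.fluxInt e
        map_add' := RT.fluxInt_add hd e.2
        map_smul' := fun k v => RT.fluxInt_smul k v e }
    obtain ⟨K, hK0, hK⟩ := exists_sq_le_mul_of_posSemidef (RT.massBilin (M := M) (fun _ => 1))
      (RT.mass_comm (fun _ => 1)) (RT.mass_self_nonneg fun _ => zero_le_one) r (fun v hv => by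
        have hv0 : v = 0 := RT.eq_zero_of_mass hd (fun _ => zero_lt_one) hv
        rw [hv0]; exact r.map_zero)
    exact ⟨K, hK0, hK⟩
  choose K hK0 hK using h
  refine ⟨∑ e, K e, Finset.sum_nonneg fun e _ => hK0 e, fun e he v => (hK ⟨e, he⟩ v).trans ?_⟩
  exact mul_le_mul_of_nonneg_right
    (Finset.single_le_sum (fun e _ => hK0 e) (Finset.mem_univ _))
    (RT.mass_self_nonneg (fun _ => zero_le_one) v)

/-- `v` solves Darcy's law with resistance `l` and face data `F`. -/
def RT.Darcy (l : M.Cell → ℝ) (F : M.Cell × M.Cell → ℝ) (v : M.RT) : Prop :=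
  v.InU0 ∧ ∀ w : M.RT, w.InU0 → RT.mass l v w = ∑ e ∈ M.interiorFaces, F e * w.fluxInt e

lemma RT.exists_darcy (hd : 0 < d) {l : M.Cell → ℝ} (hl : ∀ i, 0 < l i)
    (F : M.Cell × M.Cell → ℝ) : ∃ v : M.RT, RT.Darcy l F v := by
  let r : M.fluxSpace →ₗ[ℝ] ℝ :=
    { toFun := fun w => ∑ e ∈ M.interiorFaces, F e * w.1.fluxInt e
      map_add' := fun v w => by
        rw [← Finset.sum_add_distrib]
        exact Finset.sum_congr rfl fun e he => by
          rw [Submodule.coe_add, RT.fluxInt_add hd he, mul_add]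
      map_smul' := fun k v => by
        rw [RingHom.id_apply, smul_eq_mul, Finset.mul_sum]
        exact Finset.sum_congr rfl fun e he => by
          rw [Submodule.coe_smul, RT.fluxInt_smul, mul_left_comm] }
  obtain ⟨z, hz⟩ := exists_solution_of_symm
    ((RT.massBilin l).domRestrict₁₂ M.fluxSpace M.fluxSpace)
    (fun v w => RT.mass_comm l v.1 w.1) r (fun v hv => by
      have : v = 0 := Subtype.ext (RT.eq_zero_of_mass hd hl hv)
      rw [this, map_zero])
  exact ⟨z.1, z.2, fun w hw => hz ⟨w, hw⟩⟩

/-- Test the difference of the two laws with the difference of the fields. With `S` the sum of the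
absolute face fluxes and `X` the unweighted mass, `Cl * X ≤ r * S` and `S² ≤ const * X`; dividing by
`S` gives the bound. -/
lemma RT.exists_darcy_bound (hd : 0 < d) (M : SimplicialMesh d) :
    ∃ K : ℝ, 0 < K ∧ ∀ (l : M.Cell → ℝ) (Cl : ℝ), 0 < Cl → (∀ i, Cl ≤ l i) →
      ∀ (F F' : M.Cell × M.Cell → ℝ) (v v' : M.RT), RT.Darcy l F v → RT.Darcy l F' v' →
      ∀ r : ℝ, (∀ e ∈ M.interiorFaces, |F e - F' e| ≤ r) →
        ∀ e ∈ M.interiorFaces, |v.fluxInt e - v'.fluxInt e| ≤ K / Cl * r := by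
  obtain ⟨K, hK0, hK⟩ := RT.exists_fluxInt_sq_le hd M
  set E : ℝ := ((M.interiorFaces.card : ℕ) : ℝ) with hE
  refine ⟨E ^ 2 * K + 1, by positivity, ?_⟩
  intro l Cl hCl hl F F' v v' hv hv' r hr e he
  have hr0 : 0 ≤ r := (abs_nonneg _).trans (hr e he)
  set w := v - v' with hw
  have hwm : w.InU0 := M.fluxSpace.sub_mem hv.1 hv'.1
  have hflux : ∀ e ∈ M.interiorFaces, w.fluxInt e = v.fluxInt e - v'.fluxInt e := fun e he => by
    have := RT.fluxInt_add hd he w v'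
    rw [hw, sub_add_cancel] at this
    rw [hw, this]; ring
  have hmass : RT.mass l w w = ∑ e ∈ M.interiorFaces, (F e - F' e) * w.fluxInt e := by
    have h1 := hv.2 w hwm
    have h2 := hv'.2 w hwm
    have h3 := RT.mass_add_left l w v' w
    rw [hw, sub_add_cancel, ← hw, h1, h2] at h3
    simp only [sub_mul, Finset.sum_sub_distrib]
    linarith
  set S := ∑ e ∈ M.interiorFaces, |w.fluxInt e| with hS
  have hS0 : 0 ≤ S := Finset.sum_nonneg fun _ _ => abs_nonneg _
  set X := RT.mass (fun _ => 1) w w with hX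
  have hX1 : Cl * X ≤ RT.mass l w w := by
    rw [hX, RT.mass_eq, RT.mass_eq, Finset.mul_sum]
    refine Finset.sum_le_sum fun i _ => ?_
    rw [one_mul]
    exact mul_le_mul_of_nonneg_right (hl i) (w.cellMass_nonneg i)
  have hX2 : RT.mass l w w ≤ r * S := by
    rw [hmass, hS, Finset.mul_sum]
    refine Finset.sum_le_sum fun e he => (le_abs_self _).trans ?_
    rw [abs_mul]
    exact mul_le_mul_of_nonneg_right (hr e he) (abs_nonneg _)
  have hS2 : S ^ 2 ≤ E ^ 2 * K * X := by
    have h1 : S ^ 2 ≤ E * ∑ e ∈ M.interiorFaces, |w.fluxInt e| ^ 2 := sq_sum_le_card_mul_sum_sq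
    have h2 : ∑ e ∈ M.interiorFaces, |w.fluxInt e| ^ 2 ≤ E * (K * X) := by
      rw [hE, ← nsmul_eq_mul]
      refine Finset.sum_le_card_nsmul _ _ _ fun e he => ?_
      rw [sq_abs]; exact hK e he w
    calc S ^ 2 ≤ E * (E * (K * X)) := h1.trans (mul_le_mul_of_nonneg_left h2 (Nat.cast_nonneg _))
      _ = E ^ 2 * K * X := by ring
  have hS3 : Cl * S ≤ E ^ 2 * K * r := by
    rcases hS0.eq_or_lt with h | h
    · rw [← h, mul_zero]; positivity
    · have h1 : Cl * S ^ 2 ≤ (E ^ 2 * K * r) * S := by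
        calc Cl * S ^ 2 ≤ Cl * (E ^ 2 * K * X) := mul_le_mul_of_nonneg_left hS2 hCl.le
          _ = E ^ 2 * K * (Cl * X) := by ring
          _ ≤ E ^ 2 * K * (r * S) := mul_le_mul_of_nonneg_left (hX1.trans hX2) (by positivity)
          _ = (E ^ 2 * K * r) * S := by ring
      rw [pow_two, ← mul_assoc] at h1
      exact le_of_mul_le_mul_right h1 h
  rw [← hflux e he, div_mul_eq_mul_div, le_div_iff₀ hCl]
  have h1 : |w.fluxInt e| ≤ S :=
    Finset.single_le_sum (f := fun e => |w.fluxInt e|) (fun _ _ => abs_nonneg _) he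
  have h2 := mul_le_mul_of_nonneg_left h1 hCl.le
  linarith

/-- Piecewise constants are determined by their moments. -/
lemma Q.ext_of_moments {a b : M.Q}
    (h : ∀ q : M.Q, ∑ i, M.vol i * (a i * q i) = ∑ i, M.vol i * (b i * q i)) (i : M.Cell) :
    a i = b i := by
  have := h (Pi.single i 1)
  simp only [Pi.single_apply, mul_ite, mul_one, mul_zero, Finset.sum_ite_eq', Finset.mem_univ,
    if_true] at this
  exact mul_left_cancel₀ (M.vol_pos i).ne' this

end SimplicialMesh

/-! ### The reduced form of the scheme -/

/-- The stabilised chemical potential belonging to the density `c`. -/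
def OldLevel.chemOf (m : Medium) (o : OldLevel M) (c : M.Q) : M.Q := fun i =>
  m.chem (o.c i) + o.stab m i * (c i - o.c i)

/-- The pressure belonging to the density `c`. -/
def OldLevel.pressureOf (m : Medium) (o : OldLevel M) (c : M.Q) : M.Q := fun i =>
  o.c i * o.chemOf m c i - m.f (o.c i)

/-- The face data of Darcy's law belonging to the density `c`. -/
def OldLevel.darcyData (m : Medium) (o : OldLevel M) (c : M.Q) (e : M.Cell × M.Cell) : ℝ :=
  Q.jump (o.chemOf m c) e * o.upwind e

/-- The factor `1 / τ` cancels and the face term is the lifting tested with `q`, so the equation is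
an explicit cellwise formula free of `τ`. -/
lemma porosity_iff (hd : 0 < d) {N τ : ℝ} (hτ : 0 < τ) (α : ℝ) (φ φ' p p' : M.Q) (u u' : M.V) :
    (∀ q : M.Q, ∑ i, M.cellInt i (fun _ => (φ i - φ' i) / τ * q i) =
      1 / N * ∑ i, M.cellInt i (fun _ => (p i - p' i) / τ * q i)
      + α * ∑ i, M.cellInt i (fun _ => (u.div i - u'.div i) / τ * q i)
      - α * ∑ e ∈ M.interiorFaces, M.faceInt e (fun x =>
            inner ℝ (Q.avgNormal q e) (τ⁻¹ • (u.jump e x - u'.jump e x)))) ↔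
    ∀ i, φ i = φ' i + 1 / N * (p i - p' i) + α * (u.dgDiv i - u'.dgDiv i) := by
  have hface : ∀ q : M.Q, ∑ e ∈ M.interiorFaces, M.faceInt e (fun x =>
        inner ℝ (Q.avgNormal q e) (τ⁻¹ • (u.jump e x - u'.jump e x))) =
      ∑ i, M.vol i * ((u.lift i - u'.lift i) / τ * q i) := by
    intro q
    have h1 : ∑ i, M.vol i * ((u.lift i - u'.lift i) / τ * q i) =
        τ⁻¹ * (∑ i, M.vol i * (q i * u.lift i) - ∑ i, M.vol i * (q i * u'.lift i)) := by
      rw [← Finset.sum_sub_distrib, Finset.mul_sum]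
      exact Finset.sum_congr rfl fun _ _ => by ring
    rw [h1, V.sum_vol_mul_lift, V.sum_vol_mul_lift, ← Finset.sum_sub_distrib, Finset.mul_sum]
    refine Finset.sum_congr rfl fun e he => ?_
    have h2 : (fun x => inner ℝ (Q.avgNormal q e) (τ⁻¹ • (u.jump e x - u'.jump e x)) : Pt d → ℝ) =
        fun x => τ⁻¹ * (inner ℝ (Q.avgNormal q e) (u.jump e x) -
          inner ℝ (Q.avgNormal q e) (u'.jump e x)) := by
      funext x; rw [real_inner_smul_right, inner_sub_right]
    rw [h2, faceInt_const_mul, faceInt_sub hd he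
      (continuous_const.inner (u.continuous_jump e)) (continuous_const.inner (u'.continuous_jump e)),
      V.faceInt_inner_jump hd he, V.faceInt_inner_jump hd he, Q.avgNormal_eq,
      real_inner_smul_left, real_inner_smul_left, V.jumpFlux, V.jumpFlux]
  have hrhs : ∀ q : M.Q, 1 / N * ∑ i, M.cellInt i (fun _ => (p i - p' i) / τ * q i)
      + α * ∑ i, M.cellInt i (fun _ => (u.div i - u'.div i) / τ * q i)
      - α * ∑ e ∈ M.interiorFaces, M.faceInt e (fun x =>
            inner ℝ (Q.avgNormal q e) (τ⁻¹ • (u.jump e x - u'.jump e x))) =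
      ∑ i, M.vol i * ((1 / N * (p i - p' i) + α * (u.dgDiv i - u'.dgDiv i)) / τ * q i) := by
    intro q
    rw [hface]
    simp only [cellInt_const]
    rw [Finset.mul_sum, Finset.mul_sum, Finset.mul_sum, ← Finset.sum_add_distrib,
      ← Finset.sum_sub_distrib]
    exact Finset.sum_congr rfl fun i _ => by rw [V.dgDiv, V.dgDiv]; ring
  constructor
  · intro h i
    have h1 := Q.ext_of_moments (a := fun i => (φ i - φ' i) / τ)
      (b := fun i => (1 / N * (p i - p' i) + α * (u.dgDiv i - u'.dgDiv i)) / τ) (fun q => by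
        rw [← hrhs q, ← h q]; simp only [cellInt_const]) i
    have h2 : φ i - φ' i = 1 / N * (p i - p' i) + α * (u.dgDiv i - u'.dgDiv i) :=
      (div_left_inj' hτ.ne').1 h1
    linarith
  · intro h q
    rw [hrhs]
    simp only [cellInt_const]
    refine Finset.sum_congr rfl fun i _ => ?_
    rw [h i]; ring

/-- Potential and pressure become explicit functions of the density; only the displacement and the
flux still come from linear systems. -/
lemma Iterate.closed_iff (hd : 0 < d) (m : Medium) {γ ς₂ N τ : ℝ} (hτ : 0 < τ) (o : OldLevel M)
    (s : Iterate M) : s.Closed m γ ς₂ N τ o ↔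
      s.μ = o.chemOf m s.c ∧ s.p = o.pressureOf m s.c ∧
      (∀ v : M.V, formA m γ ς₂ s.us (o.pressureOf m s.c) v = 0) ∧
      RT.Darcy (fun i => (m.mobility (o.φ i))⁻¹) (o.darcyData m s.c) s.uf ∧
      ∀ i, s.φ i = o.φ i + 1 / N * (o.pressureOf m s.c i - o.p i) +
        m.α * (s.us.dgDiv i - o.us.dgDiv i) := by
  have hμ : (∀ i, s.μ i = m.chem (o.c i) +
      o.θ * m.R * m.T * ((s.c i - o.c i) / (o.c i * (1 - m.β * o.c i) ^ 2))) ↔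
      s.μ = o.chemOf m s.c := by
    rw [funext_iff]
    refine forall_congr' fun i => ?_
    rw [OldLevel.chemOf, OldLevel.stab, div_mul_eq_mul_div, mul_div_assoc]
  have hdarcy : ∀ w : M.RT, ∑ e ∈ M.interiorFaces,
      M.faceInt e (fun x => Q.jump (o.chemOf m s.c) e * (o.upwind e * w.flux e x)) =
      ∑ e ∈ M.interiorFaces, o.darcyData m s.c e * w.fluxInt e := fun w =>
    Finset.sum_congr rfl fun e _ => by
      rw [faceInt_const_mul, faceInt_const_mul, OldLevel.darcyData, RT.fluxInt, mul_assoc]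
  constructor
  · intro h
    have h1 := hμ.1 h.chem
    have h2 : s.p = o.pressureOf m s.c := by
      funext i
      refine Q.ext_of_moments (fun q => ?_) i
      have := h.pressure q
      simp only [cellInt_const] at this
      rw [this, h1]
      rfl
    refine ⟨h1, h2, fun v => h2 ▸ h.momentum v, ⟨h.uf_mem, fun w hw => ?_⟩, ?_⟩
    · rw [← hdarcy, ← h1]; exact h.darcy w hw
    · rw [← h2]; exact (porosity_iff hd hτ m.α _ _ _ _ _ _).1 h.porosity
  · rintro ⟨h1, h2, h3, h4, h5⟩
    refine ⟨hμ.2 h1, fun v => by rw [h2]; exact h3 v, h4.1, fun w hw => ?_, fun z => ?_, ?_⟩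
    · rw [h1, hdarcy]; exact h4.2 w hw
    · rw [h1, h2]; rfl
    · rw [h2]; exact (porosity_iff hd hτ m.α _ _ _ _ _ _).2 h5

/-- Jumps of piecewise constants are constant on faces, so `h_e` cancels in the penalty and the
velocity enters through its face integrals only. -/
lemma massBalance_iff (hd : 0 < d) (ς₁ τ : ℝ) (o : OldLevel M) (s s' : Iterate M) :
    massBalance ς₁ τ o s s' ↔ ∀ q : M.Q,
      ∑ i, M.vol i / τ * (s.φ i * s'.c i - o.φ i * o.c i) * q i
      + ∑ e ∈ M.interiorFaces, o.upwind e * s.uf.fluxInt e * (q e.1 - q e.2)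
      + ς₁ * ∑ e ∈ M.interiorFaces, (s'.μ e.1 - s'.μ e.2) * (q e.1 - q e.2) = 0 := by
  refine forall_congr' fun q => ?_
  have h1 : ∑ i, M.cellInt i (fun _ => (s.φ i * s'.c i - o.φ i * o.c i) / τ * q i) =
      ∑ i, M.vol i / τ * (s.φ i * s'.c i - o.φ i * o.c i) * q i :=
    Finset.sum_congr rfl fun i _ => by rw [cellInt_const]; ring
  have h2 : ∑ e ∈ M.interiorFaces,
      M.faceInt e (fun x => o.upwind e * s.uf.flux e x * Q.jump q e) =
      ∑ e ∈ M.interiorFaces, o.upwind e * s.uf.fluxInt e * (q e.1 - q e.2) :=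
    Finset.sum_congr rfl fun e _ => by
      have : (fun x => o.upwind e * s.uf.flux e x * Q.jump q e) =
          fun x => (o.upwind e * Q.jump q e) * s.uf.flux e x := by funext x; ring
      rw [this, faceInt_const_mul, RT.fluxInt, Q.jump]
      change _ = o.upwind e * M.faceInt e (s.uf.flux e) * _
      ring
  have h3 : ∑ e ∈ M.interiorFaces,
      ς₁ / M.hFace e * M.faceInt e (fun _ => Q.jump s'.μ e * Q.jump q e) =
      ς₁ * ∑ e ∈ M.interiorFaces, (s'.μ e.1 - s'.μ e.2) * (q e.1 - q e.2) := by
    rw [Finset.mul_sum]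
    refine Finset.sum_congr rfl fun e he => ?_
    have := (hFace_pos hd he).ne'
    rw [faceInt_const, Q.jump, Q.jump]
    field_simp
  rw [h1, h2, h3]

/-! ### Bounds for the quantities belonging to a density -/

/-- `f` is `C¹` on `(0, 1/β)`, and the admissible densities fill a compact subinterval. -/
lemma Medium.exists_chem_bound (m : Medium) {ϱ₀ ϱ : ℝ} (hϱ₀ : 0 < ϱ₀) (hϱ : ϱ < 1) :
    ∃ K : ℝ, 0 ≤ K ∧ ∀ c : ℝ, ϱ₀ ≤ m.β * c → m.β * c ≤ ϱ → |m.chem c| ≤ K ∧ |m.f c| ≤ K := by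
  have hβ := m.β_pos
  have hf : ContDiffOn ℝ 1 m.f (Set.Ioo 0 (1 / m.β)) := by
    intro c hc
    have hc0 : 0 < c := hc.1
    have hc1 : m.β * c < 1 := by
      have := hc.2
      rwa [lt_div_iff₀ hβ, mul_comm] at this
    -- Together with `β c < 1` this keeps `1 + (1 - √2) β c` positive in the last logarithm.
    have hs : √2 < 2 := by
      rw [Real.sqrt_lt' (by norm_num)]; norm_num
    have hs0 : 0 ≤ √2 := Real.sqrt_nonneg 2
    have hβc : 0 < m.β * c := mul_pos hβ hc0
    have h1 : 0 < 1 - m.β * c := by linarith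
    have h2 : 0 < 1 + (1 - √2) * m.β * c := by nlinarith
    have h3 : 0 < 1 + (1 + √2) * m.β * c := by
      have : 0 ≤ √2 * (m.β * c) := by positivity
      nlinarith
    refine ContDiffAt.contDiffWithinAt ?_
    unfold Medium.f
    have hlog1 : ContDiffAt ℝ 1 (fun c => Real.log c) c := contDiffAt_id.log hc0.ne'
    have hlog2 : ContDiffAt ℝ 1 (fun c => Real.log (1 - m.β * c)) c :=
      ContDiffAt.log (by fun_prop) h1.ne'
    have hlog3 : ContDiffAt ℝ 1 (fun c =>
        Real.log ((1 + (1 - √2) * m.β * c) / (1 + (1 + √2) * m.β * c))) c :=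
      ContDiffAt.log (ContDiffAt.div (by fun_prop) (by fun_prop) h3.ne') (div_pos h2 h3).ne'
    have hlin : ContDiffAt ℝ 1 (fun c : ℝ => c * m.R * m.T) c := by fun_prop
    have hlin' : ContDiffAt ℝ 1 (fun c : ℝ => m.b * c / (2 * √2 * m.β)) c :=
      (contDiffAt_const.mul contDiffAt_id).div_const _
    exact ((hlin.mul hlog1).add (hlin.mul hlog2).neg).add (hlin'.mul hlog3)
  have hsub : Set.Icc (ϱ₀ / m.β) (ϱ / m.β) ⊆ Set.Ioo 0 (1 / m.β) := fun c hc =>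
    ⟨(div_pos hϱ₀ hβ).trans_le hc.1, hc.2.trans_lt (div_lt_div_of_pos_right hϱ hβ)⟩
  have hd : ContinuousOn m.chem (Set.Icc (ϱ₀ / m.β) (ϱ / m.β)) :=
    (hf.continuousOn_deriv_of_isOpen isOpen_Ioo le_rfl).mono hsub
  obtain ⟨K₁, hK₁⟩ := isCompact_Icc.exists_bound_of_continuousOn hd
  obtain ⟨K₂, hK₂⟩ := isCompact_Icc.exists_bound_of_continuousOn (hf.continuousOn.mono hsub)
  refine ⟨|K₁| + |K₂|, by positivity, fun c h1 h2 => ?_⟩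
  have hc : c ∈ Set.Icc (ϱ₀ / m.β) (ϱ / m.β) :=
    ⟨by rwa [div_le_iff₀ hβ, mul_comm], by rwa [le_div_iff₀ hβ, mul_comm]⟩
  have h3 := hK₁ c hc
  have h4 := hK₂ c hc
  rw [Real.norm_eq_abs] at h3 h4
  constructor
  · linarith [le_abs_self K₁, abs_nonneg K₂]
  · linarith [le_abs_self K₂, abs_nonneg K₁]

lemma OldLevel.abs_chemOf_le {m : Medium} {o : OldLevel M} {Smax cmax K B : ℝ}
    (hS0 : ∀ i, 0 ≤ o.stab m i) (hS : ∀ i, o.stab m i ≤ Smax) (hc : ∀ i, |o.c i| ≤ cmax)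
    (hK : ∀ i, |m.chem (o.c i)| ≤ K) {c : M.Q} (hcB : ∀ i, |c i| ≤ B) (i : M.Cell) :
    |o.chemOf m c i| ≤ K + Smax * (B + cmax) := by
  have h1 : |c i - o.c i| ≤ B + cmax := (abs_sub _ _).trans (add_le_add (hcB i) (hc i))
  have h2 : |o.stab m i * (c i - o.c i)| ≤ Smax * (B + cmax) := by
    rw [abs_mul, abs_of_nonneg (hS0 i)]
    exact mul_le_mul (hS i) h1 (abs_nonneg _) ((hS0 i).trans (hS i))
  exact (abs_add_le _ _).trans (add_le_add (hK i) h2)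

lemma OldLevel.abs_pressureOf_le {m : Medium} {o : OldLevel M} {cmax K L : ℝ}
    (hc : ∀ i, |o.c i| ≤ cmax) (hf : ∀ i, |m.f (o.c i)| ≤ K) {c : M.Q}
    (hL : ∀ i, |o.chemOf m c i| ≤ L) (i : M.Cell) :
    |o.pressureOf m c i| ≤ cmax * L + K := by
  refine (abs_sub _ _).trans (add_le_add ?_ (hf i))
  rw [abs_mul]
  exact mul_le_mul (hc i) (hL i) (abs_nonneg _) ((abs_nonneg _).trans (hc i))

lemma OldLevel.abs_chemOf_sub_le {m : Medium} {o : OldLevel M} {Smax r : ℝ}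
    (hS0 : ∀ i, 0 ≤ o.stab m i) (hS : ∀ i, o.stab m i ≤ Smax) {c c' : M.Q}
    (hr : ∀ i, |c i - c' i| ≤ r) (i : M.Cell) :
    |o.chemOf m c i - o.chemOf m c' i| ≤ Smax * r := by
  have h : o.chemOf m c i - o.chemOf m c' i = o.stab m i * (c i - c' i) := by
    unfold OldLevel.chemOf; ring
  rw [h, abs_mul, abs_of_nonneg (hS0 i)]
  exact mul_le_mul (hS i) (hr i) (abs_nonneg _) ((hS0 i).trans (hS i))

lemma OldLevel.abs_pressureOf_sub_le {m : Medium} {o : OldLevel M} {cmax L : ℝ}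
    (hc : ∀ i, |o.c i| ≤ cmax) {c c' : M.Q}
    (hL : ∀ i, |o.chemOf m c i - o.chemOf m c' i| ≤ L) (i : M.Cell) :
    |o.pressureOf m c i - o.pressureOf m c' i| ≤ cmax * L := by
  have h : o.pressureOf m c i - o.pressureOf m c' i =
      o.c i * (o.chemOf m c i - o.chemOf m c' i) := by
    unfold OldLevel.pressureOf; ring
  rw [h, abs_mul]
  exact mul_le_mul (hc i) (hL i) (abs_nonneg _) ((abs_nonneg _).trans (hc i))

lemma OldLevel.abs_upwind_le {o : OldLevel M} {cmax : ℝ} (hc : ∀ i, |o.c i| ≤ cmax)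
    (e : M.Cell × M.Cell) : |o.upwind e| ≤ cmax := by
  unfold OldLevel.upwind
  split_ifs
  exacts [hc _, hc _]

lemma OldLevel.abs_darcyData_sub_le {m : Medium} {o : OldLevel M} {cmax L : ℝ}
    (hc : ∀ i, |o.c i| ≤ cmax) {c c' : M.Q}
    (hL : ∀ i, |o.chemOf m c i - o.chemOf m c' i| ≤ L) (e : M.Cell × M.Cell) :
    |o.darcyData m c e - o.darcyData m c' e| ≤ 2 * L * cmax := by
  have h : o.darcyData m c e - o.darcyData m c' e =
      ((o.chemOf m c e.1 - o.chemOf m c' e.1) - (o.chemOf m c e.2 - o.chemOf m c' e.2)) *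
        o.upwind e := by
    unfold OldLevel.darcyData Q.jump; ring
  have h1 : |(o.chemOf m c e.1 - o.chemOf m c' e.1) - (o.chemOf m c e.2 - o.chemOf m c' e.2)| ≤
      2 * L := (abs_sub _ _).trans (by linarith [hL e.1, hL e.2])
  rw [h, abs_mul]
  exact mul_le_mul h1 (abs_upwind_le hc e) (abs_nonneg _) ((abs_nonneg _).trans h1)

lemma OldLevel.abs_darcyData_le {m : Medium} {o : OldLevel M} {cmax L : ℝ}
    (hc : ∀ i, |o.c i| ≤ cmax) {c : M.Q}
    (hL : ∀ i, |o.chemOf m c i| ≤ L) (e : M.Cell × M.Cell) :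
    |o.darcyData m c e| ≤ 2 * L * cmax := by
  have h1 : |Q.jump (o.chemOf m c) e| ≤ 2 * L :=
    (abs_sub _ _).trans (by linarith [hL e.1, hL e.2])
  rw [darcyData, abs_mul]
  exact mul_le_mul h1 (abs_upwind_le hc e) (abs_nonneg _) ((abs_nonneg _).trans h1)

/-! ### The mass balance as a graph diffusion problem -/

/-- The mass balance for the next density `c'`, with porosity `φ` and advective fluxes `F`. -/
def OldLevel.Balance (m : Medium) (o : OldLevel M) (ς₁ τ : ℝ) (φ : M.Q) (F : M.Cell × M.Cell → ℝ)
    (c' : M.Q) : Prop :=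
  ∀ q : M.Q, ∑ i, M.vol i / τ * (φ i * c' i - o.φ i * o.c i) * q i
      + ∑ e ∈ M.interiorFaces, F e * (q e.1 - q e.2)
      + ς₁ * ∑ e ∈ M.interiorFaces,
          (o.chemOf m c' e.1 - o.chemOf m c' e.2) * (q e.1 - q e.2) = 0

section Balance

variable {m : Medium} {o : OldLevel M} {ς₁ τ φm : ℝ}

lemma OldLevel.weight_pos (hτ : 0 < τ) (hS : ∀ i, 0 < o.stab m i) {φ : M.Q} (hφ : ∀ i, 0 < φ i)
    (i : M.Cell) : 0 < M.vol i / τ * φ i / o.stab m i :=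
  div_pos (mul_pos (div_pos (M.vol_pos i) hτ) (hφ i)) (hS i)

/-- Change of unknown from density to potential. All of `τ` is collected in the weight, to which the
maximum principle is insensitive. -/
lemma OldLevel.balance_term (hS : ∀ i, 0 < o.stab m i) {φ : M.Q} (hφ : ∀ i, 0 < φ i) (c' : M.Q)
    (i : M.Cell) :
    M.vol i / τ * φ i / o.stab m i * (o.chemOf m c' i +
      (o.stab m i * o.c i - m.chem (o.c i) - o.stab m i * (o.φ i * o.c i) / φ i)) =
    M.vol i / τ * (φ i * c' i - o.φ i * o.c i) := by
  have h1 := (hS i).ne'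
  have h2 := (hφ i).ne'
  unfold OldLevel.chemOf
  field_simp
  ring

lemma OldLevel.exists_balance (hς : 0 < ς₁) (hτ : 0 < τ) (hS : ∀ i, 0 < o.stab m i) {φ : M.Q}
    (hφ : ∀ i, 0 < φ i) (F : M.Cell × M.Cell → ℝ) : ∃ c', o.Balance m ς₁ τ φ F c' := by
  let g : M.Q := fun i =>
    o.stab m i * o.c i - m.chem (o.c i) - o.stab m i * (o.φ i * o.c i) / φ i
  let D : M.Q := fun i => M.vol i / τ * φ i / o.stab m i
  let r : M.Q →ₗ[ℝ] ℝ :=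
    { toFun := fun q => -(∑ i, D i * g i * q i + ∑ e ∈ M.interiorFaces, F e * (q e.1 - q e.2))
      map_add' := fun a b => by
        rw [← neg_add, add_add_add_comm, ← Finset.sum_add_distrib, ← Finset.sum_add_distrib]
        simp only [Pi.add_apply]
        exact congrArg Neg.neg (congrArg₂ _ (Finset.sum_congr rfl fun _ _ => by ring)
          (Finset.sum_congr rfl fun _ _ => by ring))
      map_smul' := fun k a => by
        simp only [Pi.smul_apply, smul_eq_mul, RingHom.id_apply]
        rw [mul_neg, mul_add, Finset.mul_sum, Finset.mul_sum]
        exact congrArg Neg.neg (congrArg₂ _ (Finset.sum_congr rfl fun _ _ => by ring)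
          (Finset.sum_congr rfl fun _ _ => by ring)) }
  obtain ⟨y, hy⟩ := graph_exists M.interiorFaces D ς₁ hς (weight_pos hτ hS hφ) r
  let c' : M.Q := fun i => o.c i + (y i - m.chem (o.c i)) / o.stab m i
  have hchem : o.chemOf m c' = y := by
    funext i
    have := (hS i).ne'
    simp only [OldLevel.chemOf, c']
    field_simp
    ring
  refine ⟨c', fun q => ?_⟩
  have h1 := hy q
  change _ = -(∑ i, D i * g i * q i + ∑ e ∈ M.interiorFaces, F e * (q e.1 - q e.2)) at h1
  have h2 : ∑ i, M.vol i / τ * (φ i * c' i - o.φ i * o.c i) * q i =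
      ∑ i, D i * y i * q i + ∑ i, D i * g i * q i := by
    rw [← Finset.sum_add_distrib]
    refine Finset.sum_congr rfl fun i _ => ?_
    rw [← balance_term hS hφ, hchem]
    simp only [D, g]
    ring
  rw [h2, hchem]
  linarith

/-- The maximum principle bounds the potential; division by the slope `stab` returns to the density.
-/
lemma OldLevel.Balance.abs_le {Smin Smax cmax K H : ℝ} {φ c' : M.Q} {F : M.Cell × M.Cell → ℝ}
    (h : o.Balance m ς₁ τ φ F c') (hς : 0 < ς₁) (hτ : 0 < τ) (hSmin : 0 < Smin)
    (hS1 : ∀ i, Smin ≤ o.stab m i) (hS2 : ∀ i, o.stab m i ≤ Smax) (hφm : 0 < φm)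
    (hφ : ∀ i, φm ≤ φ i) (hφo : ∀ i, |o.φ i| ≤ 1) (hc : ∀ i, |o.c i| ≤ cmax)
    (hK : ∀ i, |m.chem (o.c i)| ≤ K) (hH : 0 ≤ H) (hF : ∀ e ∈ M.interiorFaces, |F e| ≤ H)
    (i : M.Cell) :
    |c' i| ≤ cmax + (Smax * cmax + K + Smax * cmax / φm + M.numCells * (H / ς₁) + K) / Smin := by
  have hS : ∀ i, 0 < o.stab m i := fun i => hSmin.trans_le (hS1 i)
  have hφ0 : ∀ i, 0 < φ i := fun i => hφm.trans_le (hφ i)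
  have hy := graph_abs_bound M.interiorFaces (fun i => M.vol i / τ * φ i / o.stab m i)
    (fun i => o.stab m i * o.c i - m.chem (o.c i) - o.stab m i * (o.φ i * o.c i) / φ i)
    (o.chemOf m c') F ς₁ (Smax * cmax + K + Smax * cmax / φm) H hς (weight_pos hτ hS hφ0)
    (fun i => by
      have hSc : |o.stab m i * o.c i| ≤ Smax * cmax := by
        rw [abs_mul, abs_of_pos (hS i)]
        exact mul_le_mul (hS2 i) (hc i) (abs_nonneg _) ((hS i).le.trans (hS2 i))
      have h3 : |o.stab m i * (o.φ i * o.c i) / φ i| ≤ Smax * cmax / φm := by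
        rw [abs_div, abs_of_pos (hφ0 i)]
        refine div_le_div₀ ((abs_nonneg _).trans hSc) ?_ hφm (hφ i)
        rw [mul_left_comm, abs_mul]
        exact (mul_le_of_le_one_left (abs_nonneg _) (hφo i)).trans hSc
      exact (abs_sub _ _).trans (add_le_add ((abs_sub _ _).trans (add_le_add hSc (hK i))) h3))
    hH hF (fun q => by simp only [balance_term hS hφ0]; exact h q) i
  have hci : c' i = o.c i + (o.chemOf m c' i - m.chem (o.c i)) / o.stab m i := by
    have := (hS i).ne'
    unfold OldLevel.chemOf
    field_simp
    ring
  rw [hci]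
  refine (abs_add_le _ _).trans (add_le_add (hc i) ?_)
  rw [abs_div, abs_of_pos (hS i)]
  have h4 : |o.chemOf m c' i - m.chem (o.c i)| ≤
      Smax * cmax + K + Smax * cmax / φm + M.numCells * (H / ς₁) + K :=
    (abs_sub _ _).trans (add_le_add hy (hK i))
  exact div_le_div₀ ((abs_nonneg _).trans h4) h4 hSmin (hS1 i)

/-- Writing `φ c - φ' c' = φ (c - c') + (φ - φ') c'`, the difference solves a graph problem for
`stab * (c - c')`. The change of porosity acts as a source and is made small by `N` and `γ`; the
change of flux is damped by `ς₁`. -/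
lemma OldLevel.Balance.abs_sub_le {Smin Smax a B H : ℝ} {φ φ' c c' : M.Q}
    {F F' : M.Cell × M.Cell → ℝ}
    (h : o.Balance m ς₁ τ φ F c) (h' : o.Balance m ς₁ τ φ' F' c')
    (hς : 0 < ς₁) (hτ : 0 < τ) (hSmin : 0 < Smin)
    (hS1 : ∀ i, Smin ≤ o.stab m i) (hS2 : ∀ i, o.stab m i ≤ Smax) (hφm : 0 < φm)
    (hφ : ∀ i, φm ≤ φ i) (hφφ' : ∀ i, |φ i - φ' i| ≤ a) (hB : ∀ i, |c' i| ≤ B)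
    (hH : 0 ≤ H) (hF : ∀ e ∈ M.interiorFaces, |F e - F' e| ≤ H)
    (i : M.Cell) :
    |c i - c' i| ≤ (Smax * (a * B) / φm + M.numCells * (H / ς₁)) / Smin := by
  have hS : ∀ i, 0 < o.stab m i := fun i => hSmin.trans_le (hS1 i)
  have hφ0 : ∀ i, 0 < φ i := fun i => hφm.trans_le (hφ i)
  have hy := graph_abs_bound M.interiorFaces (fun i => M.vol i / τ * φ i / o.stab m i)
    (fun i => o.stab m i * ((φ i - φ' i) * c' i) / φ i)
    (fun i => o.stab m i * (c i - c' i)) (fun e => F e - F' e) ς₁ (Smax * (a * B) / φm) H hς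
    (weight_pos hτ hS hφ0)
    (fun i => by
      rw [abs_div, abs_of_pos (hφ0 i), abs_mul, abs_mul, abs_of_pos (hS i)]
      have ha : 0 ≤ a := (abs_nonneg _).trans (hφφ' i)
      have hB0 : 0 ≤ B := (abs_nonneg _).trans (hB i)
      have hSm : 0 ≤ Smax := (hS i).le.trans (hS2 i)
      exact div_le_div₀ (by positivity) (mul_le_mul (hS2 i)
        (mul_le_mul (hφφ' i) (hB i) (abs_nonneg _) ha) (by positivity) hSm) hφm (hφ i))
    hH hF (fun q => by
      have h1 := h q
      have h2 := h' q
      have e1 : ∑ i, M.vol i / τ * φ i / o.stab m i * (o.stab m i * (c i - c' i) +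
          o.stab m i * ((φ i - φ' i) * c' i) / φ i) * q i =
          ∑ i, M.vol i / τ * (φ i * c i - o.φ i * o.c i) * q i -
          ∑ i, M.vol i / τ * (φ' i * c' i - o.φ i * o.c i) * q i := by
        rw [← Finset.sum_sub_distrib]
        refine Finset.sum_congr rfl fun i _ => ?_
        have h3 := (hS i).ne'
        have h4 := (hφ0 i).ne'
        field_simp
        ring
      have e2 : ∑ e ∈ M.interiorFaces, (F e - F' e) * (q e.1 - q e.2) =
          ∑ e ∈ M.interiorFaces, F e * (q e.1 - q e.2) -
          ∑ e ∈ M.interiorFaces, F' e * (q e.1 - q e.2) := by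
        rw [← Finset.sum_sub_distrib]
        exact Finset.sum_congr rfl fun _ _ => by ring
      have e3 : ∑ e ∈ M.interiorFaces, (o.stab m e.1 * (c e.1 - c' e.1) -
            o.stab m e.2 * (c e.2 - c' e.2)) * (q e.1 - q e.2) =
          ∑ e ∈ M.interiorFaces, (o.chemOf m c e.1 - o.chemOf m c e.2) * (q e.1 - q e.2) -
          ∑ e ∈ M.interiorFaces, (o.chemOf m c' e.1 - o.chemOf m c' e.2) * (q e.1 - q e.2) := by
        rw [← Finset.sum_sub_distrib]
        exact Finset.sum_congr rfl fun _ _ => by unfold OldLevel.chemOf; ring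
      rw [e1, e2, e3]
      linarith) i
  rw [abs_mul, abs_of_pos (hS i)] at hy
  rw [le_div_iff₀ hSmin, mul_comm]
  exact (mul_le_mul_of_nonneg_right (hS1 i) (abs_nonneg _)).trans hy

end Balance

/-! ### Energy bounds -/

lemma Q.energy_eq (hd : 0 < d) (a w : ℝ) (c : M.Q) :
    Q.energy a w c = a * ∑ i, M.vol i * c i ^ 2 +
      w * ∑ e ∈ M.interiorFaces, (c e.1 - c e.2) ^ 2 := by
  unfold Q.energy
  simp only [cellInt_const]
  congr 2
  refine Finset.sum_congr rfl fun e he => ?_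
  have := (hFace_pos hd he).ne'
  rw [faceInt_const, Q.jump]
  field_simp

lemma Q.energy_le (hd : 0 < d) {a w r : ℝ} (ha : 0 ≤ a) (hw : 0 ≤ w) {c : M.Q}
    (hr : ∀ i, |c i| ≤ r) :
    Q.energy a w c ≤ (a * ∑ i, M.vol i + 4 * w * M.interiorFaces.card) * r ^ 2 := by
  have hsq : ∀ i, c i ^ 2 ≤ r ^ 2 := fun i =>
    sq_le_sq' (by linarith [abs_le.1 (hr i)]) (abs_le.1 (hr i)).2
  have h1 : ∑ i, M.vol i * c i ^ 2 ≤ (∑ i, M.vol i) * r ^ 2 := by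
    rw [Finset.sum_mul]
    exact Finset.sum_le_sum fun i _ => mul_le_mul_of_nonneg_left (hsq i) (M.vol_pos i).le
  have h2 : ∑ e ∈ M.interiorFaces, (c e.1 - c e.2) ^ 2 ≤ M.interiorFaces.card * (4 * r ^ 2) := by
    rw [← nsmul_eq_mul]
    refine Finset.sum_le_card_nsmul _ _ _ fun e _ => ?_
    nlinarith [hsq e.1, hsq e.2, sq_nonneg (c e.1 + c e.2)]
  rw [Q.energy_eq hd]
  have h3 := mul_le_mul_of_nonneg_left h1 ha
  have h4 := mul_le_mul_of_nonneg_left h2 hw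
  linarith

/-- The jump part is dropped so that the lower bound does not depend on `w`, which grows with `ς₁`.
-/
lemma Q.le_energy (hd : 0 < d) {a w v : ℝ} (ha : 0 ≤ a) (hw : 0 ≤ w) (hv : ∀ i, v ≤ M.vol i)
    (c : M.Q) (i : M.Cell) : a * (v * c i ^ 2) ≤ Q.energy a w c := by
  have h1 : v * c i ^ 2 ≤ ∑ i, M.vol i * c i ^ 2 :=
    (mul_le_mul_of_nonneg_right (hv i) (sq_nonneg _)).trans
      (Finset.single_le_sum (f := fun i => M.vol i * c i ^ 2)
        (fun i _ => mul_nonneg (M.vol_pos i).le (sq_nonneg _)) (Finset.mem_univ i))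
  have h2 : 0 ≤ w * ∑ e ∈ M.interiorFaces, (c e.1 - c e.2) ^ 2 :=
    mul_nonneg hw (Finset.sum_nonneg fun _ _ => sq_nonneg _)
  rw [Q.energy_eq hd]
  have h3 := mul_le_mul_of_nonneg_left h1 ha
  linarith

/-! ### One step of the iteration -/

lemma exists_closed (hd : 0 < d) (m : Medium) {γ ς₂ N τ : ℝ} (hγ : 0 < γ) (hτ : 0 < τ)
    (hco : ∀ u : M.V, γ * ∑ i, M.vol i * u.dgDiv i ^ 2 ≤ elasticForm m.η γ ς₂ u u)
    (o : OldLevel M) (hl : ∀ i, 0 < (m.mobility (o.φ i))⁻¹) (c : M.Q) :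
    ∃ s : Iterate M, s.c = c ∧ s.Closed m γ ς₂ N τ o := by
  obtain ⟨u, hu⟩ := exists_momentum hd m hγ hco (o.pressureOf m c)
  obtain ⟨v, hv⟩ := RT.exists_darcy hd hl (o.darcyData m c)
  let s : Iterate M :=
    { c := c
      μ := o.chemOf m c
      p := o.pressureOf m c
      φ := fun i => o.φ i + 1 / N * (o.pressureOf m c i - o.p i) +
        m.α * (u.dgDiv i - o.us.dgDiv i)
      us := u
      uf := v }
  exact ⟨s, rfl, (s.closed_iff hd m hτ o).2 ⟨rfl, rfl, hu, hv, fun _ => rfl⟩⟩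

lemma abs_porosity_le {m : Medium} {N K γ r x y : ℝ} (hN : 0 < N) (hK : 0 < K) (hγ : 0 < γ)
    (hx : |x| ≤ r) (hy : |y| ≤ K / γ * r) : |1 / N * x + m.α * y| ≤ (1 / N + K / γ) * r := by
  have hr : 0 ≤ r := (abs_nonneg _).trans hx
  have hKr : 0 ≤ K / γ * r := by positivity
  rw [add_mul]
  refine (abs_add_le _ _).trans (add_le_add ?_ ?_)
  · rw [abs_mul, abs_of_pos (one_div_pos.2 hN)]
    exact mul_le_mul_of_nonneg_left hx (one_div_pos.2 hN).le
  · rw [abs_mul, abs_of_pos m.α_pos]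
    calc m.α * |y| ≤ 1 * (K / γ * r) :=
          mul_le_mul m.α_lt_one.le hy (abs_nonneg _) zero_le_one
      _ = K / γ * r := one_mul _

/-- The estimates for two iterates at the same time level. The constants `KD`, `KF` depend on the
mesh only. -/
structure Iterate.Stable (m : Medium) (KD KF γ ς₂ N τ Cl : ℝ) (o : OldLevel M) : Prop where
  porosity_old : ∀ s : Iterate M, s.Closed m γ ς₂ N τ o → ∀ r : ℝ,
    (∀ i, |o.pressureOf m s.c i - o.p i| ≤ r) →
    ∀ i, |s.φ i - o.φ i| ≤ (1 / N + KD / γ) * r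
  porosity : ∀ s t : Iterate M, s.Closed m γ ς₂ N τ o → t.Closed m γ ς₂ N τ o → ∀ r : ℝ,
    (∀ i, |o.pressureOf m s.c i - o.pressureOf m t.c i| ≤ r) →
    ∀ i, |s.φ i - t.φ i| ≤ (1 / N + KD / γ) * r
  flux : ∀ s : Iterate M, s.Closed m γ ς₂ N τ o → ∀ r : ℝ,
    (∀ e ∈ M.interiorFaces, |o.darcyData m s.c e| ≤ r) →
    ∀ e ∈ M.interiorFaces, |s.uf.fluxInt e| ≤ KF / Cl * r
  flux_sub : ∀ s t : Iterate M, s.Closed m γ ς₂ N τ o → t.Closed m γ ς₂ N τ o → ∀ r : ℝ,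
    (∀ e ∈ M.interiorFaces, |o.darcyData m s.c e - o.darcyData m t.c e| ≤ r) →
    ∀ e ∈ M.interiorFaces, |s.uf.fluxInt e - t.uf.fluxInt e| ≤ KF / Cl * r

lemma Iterate.exists_stable (hd : 0 < d) (M : SimplicialMesh d) :
    ∃ KD KF : ℝ, 0 < KD ∧ 0 < KF ∧ ∀ (m : Medium) (γ ς₂ N τ Cl : ℝ), 0 < γ → 0 < N → 0 < τ →
      0 < Cl → (∀ u : M.V, γ * ∑ i, M.vol i * u.dgDiv i ^ 2 ≤ elasticForm m.η γ ς₂ u u) →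
      ∀ o : OldLevel M, (∀ i, Cl ≤ (m.mobility (o.φ i))⁻¹) →
        (∀ v : M.V, formA m γ ς₂ o.us o.p v = 0) → Iterate.Stable m KD KF γ ς₂ N τ Cl o := by
  obtain ⟨KD, hKD, hD⟩ := exists_dgDiv_bound hd M
  obtain ⟨KF, hKF, hF⟩ := RT.exists_darcy_bound hd M
  refine ⟨KD, KF, hKD, hKF, fun m γ ς₂ N τ Cl hγ hN hτ hCl hco o hl hmom => ?_⟩
  constructor
  · intro s hs r hr i
    obtain ⟨-, -, h3, -, h5⟩ := (s.closed_iff hd m hτ o).1 hs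
    rw [h5 i, add_assoc, add_sub_cancel_left]
    -- The old level satisfies the momentum equation with its own pressure and serves as the second
    -- solution.
    exact abs_porosity_le hN hKD hγ (hr i) (hD m γ ς₂ hγ hco _ _ _ _ h3 hmom r hr i)
  · intro s t hs ht r hr i
    obtain ⟨-, -, h3, -, h5⟩ := (s.closed_iff hd m hτ o).1 hs
    obtain ⟨-, -, h3', -, h5'⟩ := (t.closed_iff hd m hτ o).1 ht
    have h : s.φ i - t.φ i = 1 / N * (o.pressureOf m s.c i - o.pressureOf m t.c i) +
        m.α * (s.us.dgDiv i - t.us.dgDiv i) := by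
      rw [h5, h5']; ring
    rw [h]
    exact abs_porosity_le hN hKD hγ (hr i) (hD m γ ς₂ hγ hco _ _ _ _ h3 h3' r hr i)
  · intro s hs r hr e he
    obtain ⟨-, -, -, h4, -⟩ := (s.closed_iff hd m hτ o).1 hs
    have h0 : ∀ e : M.Cell × M.Cell, RT.fluxInt (0 : M.RT) e = 0 := fun e => by
      have := RT.fluxInt_smul 0 (0 : M.RT) e
      rwa [zero_smul, zero_mul] at this
    -- The bound for a single flux is the difference bound against the zero field.
    have hzero : RT.Darcy (fun i => (m.mobility (o.φ i))⁻¹) (fun _ => 0) (0 : M.RT) :=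
      ⟨M.fluxSpace.zero_mem, fun w _ => by
        have := RT.mass_smul_left (fun i => (m.mobility (o.φ i))⁻¹) 0 (0 : M.RT) w
        rw [zero_smul, zero_mul] at this
        rw [this]; simp⟩
    have := hF _ Cl hCl hl _ _ _ _ h4 hzero r (by simpa using hr) e he
    rwa [h0, sub_zero] at this
  · intro s t hs ht r hr e he
    obtain ⟨-, -, -, h4, -⟩ := (s.closed_iff hd m hτ o).1 hs
    obtain ⟨-, -, -, h4', -⟩ := (t.closed_iff hd m hτ o).1 ht
    exact hF _ Cl hCl hl _ _ _ _ h4 h4' r hr e he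

/-- Although the displacement belonging to a density need not be unique, stability with `r = 0`
shows that porosity and face fluxes are. Any choice of `s` therefore yields the same balance. -/
lemma iterStep_iff (hd : 0 < d) {m : Medium} {KD KF γ ς₁ ς₂ N τ Cl : ℝ} (hτ : 0 < τ)
    {o : OldLevel M}
    (hex : ∀ c : M.Q, ∃ s : Iterate M, s.c = c ∧ s.Closed m γ ς₂ N τ o)
    (hst : Iterate.Stable m KD KF γ ς₂ N τ Cl o) {s : Iterate M} (hs : s.Closed m γ ς₂ N τ o)
    (c' : M.Q) : IterStep m γ ς₁ ς₂ N τ o s.c c' ↔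
      o.Balance m ς₁ τ s.φ (fun e => o.upwind e * s.uf.fluxInt e) c' := by
  constructor
  · rintro ⟨t, t', htc, rfl, ht, ht', hbal⟩ q
    have hφ : ∀ i, t.φ i = s.φ i := fun i => by
      have := hst.porosity t s ht hs 0 (fun i => by rw [htc]; simp) i
      rw [mul_zero] at this
      exact sub_eq_zero.1 (abs_nonpos_iff.1 this)
    have hflux : ∀ e ∈ M.interiorFaces, t.uf.fluxInt e = s.uf.fluxInt e := fun e he => by
      have := hst.flux_sub t s ht hs 0 (fun i _ => by rw [htc]; simp) e he
      rw [mul_zero] at this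
      exact sub_eq_zero.1 (abs_nonpos_iff.1 this)
    have h := (massBalance_iff hd ς₁ τ o t t').1 hbal q
    rw [((t'.closed_iff hd m hτ o).1 ht').1] at h
    simp only [hφ] at h
    have hsum : ∑ e ∈ M.interiorFaces, o.upwind e * t.uf.fluxInt e * (q e.1 - q e.2) =
        ∑ e ∈ M.interiorFaces, o.upwind e * s.uf.fluxInt e * (q e.1 - q e.2) :=
      Finset.sum_congr rfl fun e he => by rw [hflux e he]
    rw [hsum] at h
    exact h
  · intro h
    obtain ⟨s', rfl, hs'⟩ := hex c'
    refine ⟨s, s', rfl, rfl, hs, hs', (massBalance_iff hd ς₁ τ o s s').2 fun q => ?_⟩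
    rw [((s'.closed_iff hd m hτ o).1 hs').1]
    exact h q

/-- The iteration map on the ball of radius `B`: it is well defined, maps the ball into itself, and
is Lipschitz continuous in the sup norm. -/
lemma exists_iteration_map (hd : 0 < d) {m : Medium}
    {KD KF γ ς₁ ς₂ N τ Cl Smin Smax cmax K P φm B : ℝ} {o : OldLevel M}
    (hKF : 0 < KF) (hτ : 0 < τ) (hCl : 0 < Cl) (hς₁ : 0 < ς₁)
    (hex : ∀ c : M.Q, ∃ s : Iterate M, s.c = c ∧ s.Closed m γ ς₂ N τ o)
    (hst : Iterate.Stable m KD KF γ ς₂ N τ Cl o)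
    (hSmin : 0 < Smin) (hS1 : ∀ i, Smin ≤ o.stab m i) (hS2 : ∀ i, o.stab m i ≤ Smax)
    (hSmax : 0 ≤ Smax) (hφm : 0 < φm) (hφ1 : ∀ i, 2 * φm ≤ o.φ i) (hφ2 : ∀ i, o.φ i ≤ 1)
    (hcmax : 0 ≤ cmax) (hc : ∀ i, |o.c i| ≤ cmax) (hK0 : 0 ≤ K)
    (hK : ∀ i, |m.chem (o.c i)| ≤ K) (hKf : ∀ i, |m.f (o.c i)| ≤ K) (hP : ∀ i, |o.p i| ≤ P)
    (hB0 : 0 ≤ B)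
    (hB : cmax + (Smax * cmax + K + Smax * cmax / φm + 1 + K) / Smin ≤ B)
    (hflux : M.numCells *
      (cmax * (KF / Cl * (2 * (K + Smax * (B + cmax)) * cmax)) / ς₁) ≤ 1)
    (hpor : (1 / N + KD / γ) * (cmax * (K + Smax * (B + cmax)) + K + P) ≤ φm) :
    ∃ F : M.Q → M.Q,
      (∀ c : M.Q, (∀ i, |c i| ≤ B) →
        (∀ c' : M.Q, IterStep m γ ς₁ ς₂ N τ o c c' ↔ c' = F c) ∧ ∀ i, |F c i| ≤ B) ∧
      ∀ c₁ c₂ : M.Q, (∀ i, |c₁ i| ≤ B) → (∀ i, |c₂ i| ≤ B) →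
        ∀ r : ℝ, 0 ≤ r → (∀ i, |c₁ i - c₂ i| ≤ r) → ∀ i, |F c₁ i - F c₂ i| ≤
          (Smax * ((1 / N + KD / γ) * (cmax * (Smax * r)) * B) / φm +
            M.numCells * (cmax * (KF / Cl * (2 * (Smax * r) * cmax)) / ς₁)) / Smin := by
  classical
  have hS0 : ∀ i, 0 < o.stab m i := fun i => hSmin.trans_le (hS1 i)
  have hφabs : ∀ i, |o.φ i| ≤ 1 := fun i => by
    rw [abs_of_nonneg (by linarith [hφ1 i])]; exact hφ2 i
  set L := K + Smax * (B + cmax) with hL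
  have hL0 : 0 ≤ L := by positivity
  have hchem : ∀ c : M.Q, (∀ i, |c i| ≤ B) → ∀ i, |o.chemOf m c i| ≤ L := fun c hcB =>
    OldLevel.abs_chemOf_le (fun i => (hS0 i).le) hS2 hc hK hcB
  -- The old porosity is at least `2 * φm`, and `hpor` limits its change to `φm`.
  have hφs : ∀ s : Iterate M, s.Closed m γ ς₂ N τ o → (∀ i, |s.c i| ≤ B) → ∀ i, φm ≤ s.φ i := by
    intro s hs hsB i
    have h1 := hst.porosity_old s hs (cmax * L + K + P) (fun i =>
      (abs_sub _ _).trans (add_le_add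
        (OldLevel.abs_pressureOf_le hc hKf (hchem s.c hsB) i) (hP i))) i
    have h2 := abs_le.1 (h1.trans hpor)
    linarith [hφ1 i, h2.1]
  have hHs : ∀ s : Iterate M, s.Closed m γ ς₂ N τ o → (∀ i, |s.c i| ≤ B) →
      ∀ e ∈ M.interiorFaces,
        |o.upwind e * s.uf.fluxInt e| ≤ cmax * (KF / Cl * (2 * L * cmax)) := by
    intro s hs hsB e he
    rw [abs_mul]
    exact mul_le_mul (OldLevel.abs_upwind_le hc e)
      (hst.flux s hs _ (fun e _ => OldLevel.abs_darcyData_le hc (hchem s.c hsB) e) e he)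
      (abs_nonneg _) hcmax
  choose S hSc hS using hex
  have hSB : ∀ c : M.Q, (∀ i, |c i| ≤ B) → ∀ i, |(S c).c i| ≤ B := fun c h => by rwa [hSc]
  have hbal : ∀ c : M.Q, ∃ c' : M.Q, (∀ i, |c i| ≤ B) → o.Balance m ς₁ τ (S c).φ
      (fun e => o.upwind e * (S c).uf.fluxInt e) c' := fun c => by
    by_cases h : ∀ i, |c i| ≤ B
    · obtain ⟨c', hc'⟩ := OldLevel.exists_balance (o := o) hς₁ hτ hS0
        (fun i => hφm.trans_le (hφs _ (hS c) (hSB c h) i))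
        (fun e => o.upwind e * (S c).uf.fluxInt e)
      exact ⟨c', fun _ => hc'⟩
    -- Outside the ball the porosity may lose its sign; the value there is a dummy.
    · exact ⟨0, fun h' => absurd h' h⟩
  choose F hF using hbal
  have hmap : ∀ c : M.Q, (∀ i, |c i| ≤ B) → ∀ i, |F c i| ≤ B := by
    intro c hcB i
    refine ((hF c hcB).abs_le hς₁ hτ hSmin hS1 hS2 hφm (hφs _ (hS c) (hSB c hcB)) hφabs hc hK
      (by positivity) (hHs _ (hS c) (hSB c hcB)) i).trans (le_trans ?_ hB)
    gcongr
  refine ⟨F, fun c hcB => ⟨fun c' => ?_, hmap c hcB⟩, ?_⟩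
  · have hiff := iterStep_iff (ς₁ := ς₁) hd hτ (fun c => ⟨S c, hSc c, hS c⟩) hst (hS c) c'
    rw [hSc] at hiff
    rw [hiff]
    constructor
    · intro h
      funext i
      -- Uniqueness is the difference estimate with equal porosities and equal fluxes.
      have := h.abs_sub_le (hF c hcB) (a := 0) (B := B) (H := 0) hς₁ hτ hSmin hS1 hS2 hφm
        (hφs _ (hS c) (hSB c hcB)) (fun i => by simp) (hmap c hcB) le_rfl (fun e _ => by simp) i
      simp only [zero_mul, mul_zero, zero_div, add_zero] at this
      exact sub_eq_zero.1 (abs_nonpos_iff.1 this)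
    · rintro rfl
      exact hF c hcB
  · intro c₁ c₂ h₁ h₂ r hr0 hr
    have hr' : ∀ i, |(S c₁).c i - (S c₂).c i| ≤ r := by rwa [hSc, hSc]
    have hchem' := OldLevel.abs_chemOf_sub_le (m := m) (fun i => (hS0 i).le) hS2 hr'
    refine (hF c₁ h₁).abs_sub_le (hF c₂ h₂) hς₁ hτ hSmin hS1 hS2 hφm
      (hφs _ (hS c₁) (hSB c₁ h₁)) ?_ (hmap c₂ h₂) (by positivity) ?_
    · exact hst.porosity _ _ (hS c₁) (hS c₂) _ (OldLevel.abs_pressureOf_sub_le hc hchem')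
    · intro e he
      rw [← mul_sub, abs_mul]
      exact mul_le_mul (OldLevel.abs_upwind_le hc e)
        (hst.flux_sub _ _ (hS c₁) (hS c₂) _
          (fun e _ => OldLevel.abs_darcyData_sub_le hc hchem' e) e he)
        (abs_nonneg _) hcmax

/-- The jump weight `w` grows at most linearly in `ς₁`, whereas the squared sup-norm factor is `k² /
ς₁²`; the quotient of the energies is thus of order `1 / ς₁`. -/
lemma energy_contraction (hd : 0 < d) {a w v ς₁ Cμ k : ℝ} (ha : 0 < a) (hw : 0 < w)
    (hv : 0 < v) (hvol : ∀ i, v ≤ M.vol i) (hς₁ : 1 ≤ ς₁)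
    (hwς : w ≤ ς₁ * Cμ)
    (hlarge : 4 * ((a * ∑ i, M.vol i + 4 * Cμ * M.interiorFaces.card) * k ^ 2) ≤ ς₁ * (a * v))
    {c c' : M.Q} (hne : c ≠ 0) (hc' : ∀ i, |c' i| ≤ k / ς₁ * ‖c‖) :
    Q.energy a w c' < 1 / 2 * Q.energy a w c := by
  have hς : 0 < ς₁ := by linarith
  obtain ⟨i, hi⟩ : ∃ i, |c i| = ‖c‖ := by
    have hn : Nonempty M.Cell := by
      by_contra h
      rw [not_nonempty_iff] at h
      exact hne (Subsingleton.elim _ _)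
    obtain ⟨i, -, hi⟩ := Finset.exists_mem_eq_sup' (Finset.univ_nonempty (α := M.Cell))
      (fun i => |c i|)
    refine ⟨i, le_antisymm (norm_le_pi_norm c i) ?_⟩
    refine (pi_norm_le_iff_of_nonneg (abs_nonneg _)).2 fun j => ?_
    rw [Real.norm_eq_abs, ← hi]
    exact Finset.le_sup' (fun i => |c i|) (Finset.mem_univ j)
  have hc0 : 0 < ‖c‖ := norm_pos_iff.2 hne
  have h1 := Q.energy_le hd ha.le hw.le hc'
  have h2 := Q.le_energy hd ha.le hw.le hvol c i
  rw [← sq_abs, hi] at h2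
  have hT : 0 ≤ ∑ i, M.vol i := Finset.sum_nonneg fun i _ => (M.vol_pos i).le
  have hcard : (0 : ℝ) ≤ M.interiorFaces.card := Nat.cast_nonneg _
  have h3 : a * ∑ i, M.vol i + 4 * w * M.interiorFaces.card ≤
      ς₁ * (a * ∑ i, M.vol i + 4 * Cμ * M.interiorFaces.card) := by
    have e1 : a * ∑ i, M.vol i ≤ ς₁ * (a * ∑ i, M.vol i) :=
      le_mul_of_one_le_left (mul_nonneg ha.le hT) hς₁
    have e2 := mul_le_mul_of_nonneg_right hwς hcard
    linarith
  set X := a * ∑ i, M.vol i + 4 * Cμ * M.interiorFaces.card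
  have h4 : (k / ς₁ * ‖c‖) ^ 2 = k ^ 2 / ς₁ ^ 2 * ‖c‖ ^ 2 := by ring
  have h5 : Q.energy a w c' ≤ X * k ^ 2 / ς₁ * ‖c‖ ^ 2 := by
    refine h1.trans ((mul_le_mul_of_nonneg_right h3 (sq_nonneg _)).trans (le_of_eq ?_))
    rw [h4]; field_simp
  -- A quarter instead of a half leaves room for the strict inequality.
  have h6 : X * k ^ 2 / ς₁ ≤ a * v / 4 := by
    rw [div_le_iff₀ hς]; linarith
  have h7 := mul_le_mul_of_nonneg_right h6 (sq_nonneg ‖c‖)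
  have h8 : 0 < a * (v * ‖c‖ ^ 2) := by positivity
  linarith

end

end PoroFlow

/-! ### Choice of the parameters. -/

theorem lemma5p1 (d : ℕ) (hd : d = 2 ∨ d = 3) (M : PoroFlow.SimplicialMesh d)
    (m : PoroFlow.Medium) (ϱ₀ ϱ Cφmin Cφmax Cl Cμmin Cμmax P C : ℝ)
    (hϱ₀ : 0 < ϱ₀) (hϱ : ϱ < 1) (hCφmin : 0 < Cφmin) (hCφmax : Cφmax < 1)
    (hCl : 0 < Cl) (hCμmin : 0 < Cμmin) (hC : 0 < C) :
    ∃ B₀ : ℝ, ∀ B ≥ B₀,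
    ∃ ς₁₀ : ℝ, ∀ ς₁ ≥ ς₁₀,
    0 < ς₁ * Cμmin - ϱ ^ 2 * C / (m.β ^ 2 * Cl) ∧
    ∃ γ₀ N₀ : ℝ, ∀ γ ≥ γ₀, ∀ N ≥ N₀,
    ∃ ς₂₀ : ℝ, ∀ ς₂ ≥ ς₂₀,
    ∃ Ccon : ℝ, 0 < Ccon ∧ Ccon < 1 ∧
    ∀ (τ : ℝ) (_ : 0 < τ) (o : PoroFlow.OldLevel M)
      (_ : o.Admissible m γ ς₂ ϱ₀ ϱ Cφmin Cφmax Cl Cμmin Cμmax P),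
    ∃ F : M.Q → M.Q,
      (∀ c : M.Q, (∀ i, |c i| ≤ B) →
        (∀ c' : M.Q, PoroFlow.IterStep m γ ς₁ ς₂ N τ o c c' ↔ c' = F c) ∧ ∀ i, |F c i| ≤ B) ∧
      ∀ c₁ c₂ : M.Q, (∀ i, |c₁ i| ≤ B) → (∀ i, |c₂ i| ≤ B) → c₁ ≠ c₂ →
        PoroFlow.SimplicialMesh.Q.energy (3 * Cφmin / 4)
            (ς₁ * Cμmin - ϱ ^ 2 * C / (m.β ^ 2 * Cl)) (F c₁ - F c₂) <
          Ccon * PoroFlow.SimplicialMesh.Q.energy (3 * Cφmin / 4)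
            (ς₁ * Cμmin - ϱ ^ 2 * C / (m.β ^ 2 * Cl)) (c₁ - c₂) := by
  have hd0 : 0 < d := by omega
  have hβ := m.β_pos
  obtain ⟨v, hv, hvol⟩ := M.exists_vol_lower
  obtain ⟨K, hK0, hK⟩ := m.exists_chem_bound hϱ₀ hϱ
  obtain ⟨KD, KF, hKD, hKF, hstab⟩ := PoroFlow.Iterate.exists_stable hd0 M
  set cmax := |ϱ| / m.β with hcmax
  have hcmax0 : 0 ≤ cmax := by positivity
  set Smax := |Cμmax| with hSmaxdef
  have hSmax : 0 ≤ Smax := abs_nonneg _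
  set φm := Cφmin / 2 with hφmdef
  have hφm : 0 < φm := by positivity
  set X := ϱ ^ 2 * C / (m.β ^ 2 * Cl) with hX
  have hX0 : 0 ≤ X := by positivity
  -- The `1` stands for the flux contribution `numCells * (H / ς₁)`. Since `H` depends on `B`, it
  -- cannot appear in the radius and is made at most `1` by `ς₁` afterwards.
  refine ⟨cmax + (Smax * cmax + K + Smax * cmax / φm + 1 + K) / Cμmin, fun B hB => ?_⟩
  have hB0 : 0 ≤ B := le_trans (by positivity) hB
  set L := K + Smax * (B + cmax) with hL
  have hL0 : 0 ≤ L := by positivity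
  set H := cmax * (KF / Cl * (2 * L * cmax)) with hH
  have hH0 : 0 ≤ H := by positivity
  set a := 3 * Cφmin / 4 with ha
  have ha0 : 0 < a := by positivity
  -- The Lipschitz constant of the step is `k₁ / ς₁ + (1 / N + KD / γ) * k₂`: fluxes give `k₁`, the
  -- porosity gives `k₂`.
  set k₁ := M.numCells * (cmax * (KF / Cl * (2 * Smax * cmax))) / Cμmin with hk₁
  have hk₁0 : 0 ≤ k₁ := by positivity
  set k₂ := Smax * (cmax * Smax * B) / φm / Cμmin with hk₂
  have hk₂0 : 0 ≤ k₂ := by positivity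
  have hT : 0 ≤ ∑ i, M.vol i := Finset.sum_nonneg fun i _ => (M.vol_pos i).le
  set Y := (a * ∑ i, M.vol i + 4 * Cμmin * M.interiorFaces.card) * (k₁ + 1) ^ 2 with hY
  have hY0 : 0 ≤ Y := by positivity
  -- In order, the summands ensure `1 ≤ ς₁`, the flux condition for the ball, positivity of the jump
  -- weight, and the contraction.
  refine ⟨1 + M.numCells * H + X / Cμmin + 4 * Y / (a * v), fun ς₁ hς₁ => ?_⟩
  have hn0 : 0 ≤ M.numCells * H := by positivity
  have hXC : 0 ≤ X / Cμmin := by positivity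
  have hYa : 0 ≤ 4 * Y / (a * v) := by positivity
  have hς1 : 1 ≤ ς₁ := by linarith
  have hς0 : 0 < ς₁ := by linarith
  have hflux : M.numCells * (H / ς₁) ≤ 1 := by
    rw [← mul_div_assoc, div_le_one hς0]; linarith
  have hw : 0 < ς₁ * Cμmin - X := by
    have : X / Cμmin < ς₁ := by linarith
    rw [div_lt_iff₀ hCμmin] at this
    linarith
  have hlarge : 4 * Y ≤ ς₁ * (a * v) := by
    rw [← div_le_iff₀ (by positivity)]; linarith
  refine ⟨hw, ?_⟩
  -- Bound to be imposed on `1 / N + KD / γ`: the first entry keeps the porosity above `φm`, the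
  -- second makes the porosity part of the Lipschitz constant at most `1 / ς₁`. Half of `ε` is
  -- allotted to each summand.
  set ε := min (φm / (cmax * L + K + |P| + 1)) (1 / (ς₁ * (k₂ + 1))) with hε
  have hε0 : 0 < ε := lt_min (by positivity) (by positivity)
  refine ⟨2 * KD / ε, 2 / ε, fun γ hγ N hN => ?_⟩
  have hγ0 : 0 < γ := lt_of_lt_of_le (by positivity) hγ
  have hN0 : 0 < N := lt_of_lt_of_le (by positivity) hN
  have hε1 : 1 / N + KD / γ ≤ ε := by
    have h1 : 1 / N ≤ ε / 2 := by
      rw [ge_iff_le, div_le_iff₀ hε0] at hN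
      rw [div_le_iff₀ hN0]; linarith
    have h2 : KD / γ ≤ ε / 2 := by
      rw [ge_iff_le, div_le_iff₀ hε0] at hγ
      rw [div_le_iff₀ hγ0]; linarith
    linarith
  have hδ0 : 0 ≤ 1 / N + KD / γ := by positivity
  have hpor : (1 / N + KD / γ) * (cmax * L + K + |P|) ≤ φm := by
    have h1 := hε1.trans (min_le_left _ _)
    rw [le_div_iff₀ (by positivity)] at h1
    linarith
  have hδς : (1 / N + KD / γ) * k₂ ≤ 1 / ς₁ := by
    have h1 := hε1.trans (min_le_right _ _)
    rw [le_div_iff₀ (by positivity)] at h1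
    rw [le_div_iff₀ hς0]
    have h2 : (1 / N + KD / γ) * (ς₁ * (k₂ + 1)) =
        (1 / N + KD / γ) * k₂ * ς₁ + (1 / N + KD / γ) * ς₁ := by ring
    linarith [mul_nonneg hδ0 hς0.le]
  obtain ⟨ς₂₀, hς₂₀⟩ := PoroFlow.exists_penalty hd0 M m.η_pos hγ0
  refine ⟨ς₂₀, fun ς₂ hς₂ => ⟨1 / 2, by norm_num, by norm_num, fun τ hτ o ho => ?_⟩⟩
  have hco := hς₂₀ ς₂ hς₂
  have hst := hstab m γ ς₂ N τ Cl hγ0 hN0 hτ hCl hco o ho.invMobility_lower ho.momentum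
  have hex := PoroFlow.exists_closed (N := N) hd0 m hγ0 hτ hco o
    (fun i => hCl.trans_le (ho.invMobility_lower i))
  obtain ⟨F, hF1, hF2⟩ := PoroFlow.exists_iteration_map (P := |P|) hd0 hKF hτ hCl hς0 hex hst
    hCμmin ho.stab_lower (fun i => (ho.stab_upper i).trans (le_abs_self _)) hSmax hφm
    (fun i => by linarith [ho.φ_lower i]) (fun i => (ho.φ_upper i).trans hCφmax.le) hcmax0
    (fun i => by
      have h1 : 0 < o.c i := by
        have := hϱ₀.trans_le (ho.c_lower i)
        exact pos_of_mul_pos_right this hβ.le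
      rw [abs_of_pos h1, hcmax, le_div_iff₀ hβ, mul_comm]
      exact (ho.c_upper i).trans (le_abs_self _))
    hK0 (fun i => (hK _ (ho.c_lower i) (ho.c_upper i)).1)
    (fun i => (hK _ (ho.c_lower i) (ho.c_upper i)).2)
    (fun i => (ho.p_bound i).trans (le_abs_self _)) hB0 hB hflux hpor
  refine ⟨F, hF1, fun c₁ c₂ h₁ h₂ hne => ?_⟩
  -- The porosity part contributes the `1` in `k₁ + 1`, so that `k` does not depend on `ς₁`.
  refine PoroFlow.energy_contraction hd0 ha0 hw hv hvol hς1 (k := k₁ + 1)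
    (by linarith) hlarge (sub_ne_zero.2 hne) fun i => ?_
  refine (hF2 c₁ c₂ h₁ h₂ ‖c₁ - c₂‖ (norm_nonneg _)
    (fun i => norm_le_pi_norm (c₁ - c₂) i) i).trans ?_
  set r := ‖c₁ - c₂‖
  have hr : 0 ≤ r := norm_nonneg _
  have h1 : (Smax * ((1 / N + KD / γ) * (cmax * (Smax * r)) * B) / φm +
      M.numCells * (cmax * (KF / Cl * (2 * (Smax * r) * cmax)) / ς₁)) / Cμmin =
      ((1 / N + KD / γ) * k₂ + k₁ * (1 / ς₁)) * r := by
    rw [hk₁, hk₂]; ring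
  rw [h1]
  refine mul_le_mul_of_nonneg_right ?_ hr
  have h2 : (k₁ + 1) / ς₁ = 1 / ς₁ + k₁ * (1 / ς₁) := by ring
  rw [h2]
  linarith
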